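/- Let $(\xi_k)_{k\in\mathbb{Z}}$ be a strictly stationary Markov chain on a probability space $(\Omega,\mathcal F,\mathbb P)$ with values in an arbitrary measurable space $(S,\mathcal S)$, and let $\pi$ be the law of $\xi_0$. Let $f:S\to\mathbb R$ be measurable with $\int f^2\,d\pi<\infty$ and $\int f\,d\pi=0$, and put $S_n=\sum_{i=1}^n f(\xi_i)$. Write $\|\cdot\|$ for the norm of $\mathbb L^2(\Omega,\mathcal F,\mathbb P)$. For sub-$\sigma$-algebras $\mathcal A,\mathcal B$ of $\mathcal F$ let $$\rho(\mathcal A,\mathcal B)=\sup\frac{|E(XY)|}{\|X\|\,\|Y\|},$$ the supremum being over all square integrable random variables $X,Y$ with mean zero that are $\mathcal A$-measurable and $\mathcal B$-measurable respectively (with $0/0=0$), and let $\rho^*_n=\sup\rho(\sigma(\xi_i,i\in I),\sigma(\xi_j,j\in J))$, the supremum being over all pairs of disjoint nonempty sets $I,J\subset\mathbb Z$ with $|i-j|\ge n$ for all $i\in I$, $j\in J$. Assume that the chain is $\rho^*$-mixing, that is, $\rho^*_n\to0$ as $n\to\infty$. Then the limit $$\sigma^2=\lim_{n\to\infty}\frac1n\|S_n-E(S_n\mid\xi_0,\xi_n)\|^2\in[0,\infty)$$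 exists, and, as $n\to\infty$, $$\frac1n\|E(S_n\mid\xi_0,\xi_n)\|^2\to0,\qquad \frac{E(S_n^2)}n\to\sigma^2,\qquad \frac{S_n}{\sqrt n}\Rightarrow N(0,\sigma^2),$$ where $\Rightarrow$ denotes convergence in distribution and $N(0,0)$ is the point mass at $0$. -/

import Mathlib

open MeasureTheory ProbabilityTheory Filter Topology
open scoped NNReal ENNReal

namespace InterlacedMixing

variable {Ω S : Type*} [mΩ : MeasurableSpace Ω] [mS : MeasurableSpace S]

/-- The σ-algebra `σ(ξ_i, i ∈ I)` generated by the variables of the process with index in `I`. -/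
abbrev sigmaGen (ξ : ℤ → Ω → S) (I : Set ℤ) : MeasurableSpace Ω :=
  ⨆ i ∈ I, MeasurableSpace.comap (ξ i) mS

/-- Strict stationarity: the shifted process has the same law on `S^ℤ` as the process. -/
def IsStationary (P : Measure Ω) (ξ : ℤ → Ω → S) : Prop :=
  P.map (fun ω (k : ℤ) => ξ (k + 1) ω) = P.map (fun ω (k : ℤ) => ξ k ω)

/-- The Markov property with respect to the past `σ(ξ_k, k ≤ n)`:
`P(ξ_{n+1} ∈ B | σ(ξ_k, k ≤ n)) = P(ξ_{n+1} ∈ B | ξ_n)` almost surely. -/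
def IsMarkovChain (P : Measure Ω) (ξ : ℤ → Ω → S) : Prop :=
  ∀ (n : ℤ) (B : Set S), MeasurableSet B →
    P[Set.indicator (ξ (n + 1) ⁻¹' B) (fun _ => (1 : ℝ)) | sigmaGen ξ (Set.Iic n)]
      =ᵐ[P] P[Set.indicator (ξ (n + 1) ⁻¹' B) (fun _ => (1 : ℝ)) | sigmaGen ξ {n}]

/-- The norm of `L²(Ω, P)`. -/
noncomputable def l2Norm (P : Measure Ω) (X : Ω → ℝ) : ℝ :=
  (eLpNorm X 2 P).toReal

/-- `L²₀(𝒜)`: the `𝒜`-measurable, square integrable random variables with zero mean. -/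
def MemL20 {Ω : Type*} (A : MeasurableSpace Ω) [MeasurableSpace Ω] (P : Measure Ω)
    (f : Ω → ℝ) : Prop :=
  Measurable[A] f ∧ MemLp f 2 P ∧ ∫ ω, f ω ∂P = 0

/-- The maximal coefficient of correlation `ρ(𝒜, ℬ)`; a quotient `0 / 0` counts as `0`. -/
noncomputable def maxCorr {Ω : Type*} (A B : MeasurableSpace Ω) [MeasurableSpace Ω]
    (P : Measure Ω) : ℝ≥0∞ :=
  ⨆ (f : Ω → ℝ) (_ : MemL20 A P f) (g : Ω → ℝ) (_ : MemL20 B P g),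
    ENNReal.ofReal (|∫ ω, f ω * g ω ∂P| / (l2Norm P f * l2Norm P g))

/-- The interlaced mixing coefficient `ρ*_n`: the supremum of `ρ(σ(ξ_i, i ∈ I), σ(ξ_j, j ∈ J))`
over all pairs of disjoint nonempty sets of integers at distance at least `n`. -/
noncomputable def rhoStar (P : Measure Ω) (ξ : ℤ → Ω → S) (n : ℕ) : ℝ≥0∞ :=
  ⨆ (I : Set ℤ) (J : Set ℤ) (_ : I.Nonempty) (_ : J.Nonempty) (_ : Disjoint I J)
    (_ : ∀ i ∈ I, ∀ j ∈ J, (n : ℤ) ≤ |i - j|), maxCorr (sigmaGen ξ I) (sigmaGen ξ J) P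

/-- The process is `ρ*`-mixing if `ρ*_n → 0`. -/
def IsRhoStarMixing (P : Measure Ω) (ξ : ℤ → Ω → S) : Prop :=
  Tendsto (rhoStar P ξ) atTop (𝓝 0)

/-- The partial sum `S_n = f(ξ_1) + ... + f(ξ_n)`. -/
noncomputable def partialSum (ξ : ℤ → Ω → S) (f : S → ℝ) (n : ℕ) (ω : Ω) : ℝ :=
  ∑ i ∈ Finset.Icc 1 n, f (ξ (i : ℤ) ω)

/-- `E(S_n | ξ_0, ξ_n)`. -/
noncomputable def condMean (P : Measure Ω) (ξ : ℤ → Ω → S) (f : S → ℝ) (n : ℕ) : Ω → ℝ :=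
  P[partialSum ξ f n | sigmaGen ξ {0, (n : ℤ)}]

end InterlacedMixing

/-! Mixing enters only through a covariance inequality, `CovLe`: for each r > 0 there is a gap p
such that square integrable functions of variables with p-separated index sets have covariance at
most r times the product of their L² norms. The index sets may interlace, so the inequality applies
to any splitting of a family of spaced points or blocks into two groups.

Variances. Given vectors y_i in a Hilbert space, signs can be chosen so that the signed sum has
squared norm at most Σ‖y_i‖². If the plus and minus groups a and b have correlation at most r, then
‖a + b‖² and ‖a - b‖² agree up to the factor (1 + r)/(1 - r). Hence sums over spaced blocks are
almost subadditive in variance (`CorrLe.norm_sum_block_sq_le`). With single points as blocks this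
gives Var S_n = O(n). With long blocks of length m it gives ‖S_n‖/√n ≤ (1 + o(1)) ‖S_m‖/√m + o(1),
so that limsup ≤ liminf and ‖S_n‖/√n converges to some v (`tendsto_norm_sum_div_sqrt`).

Conditional mean. V = E(S_n | ξ_0, ξ_n) satisfies ‖V‖² = E(V S_n). Indices at distance at least p
from 0 and n contribute at most r‖V‖ O(√n), and the 2p others at most ‖V‖ O(√p). Thus ‖V‖ = o(√n),
and by Pythagoras S_n - V has the same limiting variance as S_n.

Normal limit. For bounded f, repeated halving of spaced sets gives E S_n⁴ = O(n²). Cut (0, n] into k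
blocks with gaps p. The characteristic function of the sum almost factors, and each factor is
expanded to second order with the third moment controlled by the second and fourth. One lets n tend
to infinity with k and p fixed; k, and then p, have been chosen beforehand to make the remaining
errors small. A general f is approximated in L² by bounded centred functions. The variance bound is
uniform in f, so variances and characteristic functions are both stable under this approximation. -/

namespace InterlacedMixing

open scoped InnerProductSpace

/-! ### Separated index sets and blocks of integers -/

/-- Two sets of integers at distance at least `p`. -/
def Separated (p : ℕ) (s t : Set ℤ) : Prop :=
  ∀ i ∈ s, ∀ j ∈ t, (p : ℤ) ≤ |i - j|

lemma Separated.symm {p : ℕ} {s t : Set ℤ} (h : Separated p s t) : Separated p t s :=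
  fun i hi j hj => by rw [abs_sub_comm]; exact h j hj i hi

lemma Separated.of_le {p q : ℕ} {s t : Set ℤ} (h : Separated q s t) (hpq : p ≤ q) :
    Separated p s t :=
  fun i hi j hj => (Int.ofNat_le.2 hpq).trans (h i hi j hj)

lemma Separated.disjoint {p : ℕ} (hp : 1 ≤ p) {s t : Set ℤ} (h : Separated p s t) :
    Disjoint s t := by
  rw [Set.disjoint_left]
  intro i hs ht
  have := h i hs i ht
  simp only [sub_self, abs_zero] at this
  omega

lemma Separated.biUnion {ι : Type*} [DecidableEq ι] {p : ℕ} {b : ι → Finset ℤ} {s t : Finset ι}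
    (h : ∀ i ∈ s, ∀ j ∈ t, Separated p (b i : Set ℤ) (b j)) :
    Separated p (s.biUnion b : Finset ℤ) (t.biUnion b : Finset ℤ) := by
  intro i hi j hj
  simp only [Finset.coe_biUnion, Set.mem_iUnion, Finset.mem_coe] at hi hj
  obtain ⟨u, hu, hiu⟩ := hi
  obtain ⟨v, hv, hjv⟩ := hj
  exact h u hu v hv i hiu j hjv

/-- A set of integers whose distinct elements are at distance at least `p`. -/
def IsSpaced (p : ℕ) (s : Set ℤ) : Prop :=
  ∀ i ∈ s, ∀ j ∈ s, i ≠ j → (p : ℤ) ≤ |i - j|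

lemma isSpaced_filter_emod (p : ℕ) (s : Finset ℤ) (a : ℤ) :
    IsSpaced p (s.filter (fun i => i % p = a) : Finset ℤ) := by
  intro i hi j hj hij
  simp only [Finset.coe_filter, Set.mem_ofPred_eq] at hi hj
  have hd : (p : ℤ) ∣ i - j :=
    Int.ModEq.dvd (show j ≡ i [ZMOD p] from hj.2.trans hi.2.symm)
  exact Int.le_of_dvd (abs_pos.2 (sub_ne_zero.2 hij)) ((dvd_abs _ _).2 hd)

/-- The interval `(j L, j L + l]` of integers. -/
noncomputable def block (L l j : ℕ) : Finset ℤ := Finset.Ioc ((j * L : ℕ) : ℤ) ((j * L + l : ℕ) : ℤ)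

lemma separated_block {L l i j : ℕ} (hl : l ≤ L) (hij : i ≠ j) :
    Separated (L - l) (block L l i : Set ℤ) (block L l j) := by
  have key : ∀ i j : ℕ, i < j → Separated (L - l) (block L l i : Set ℤ) (block L l j) := by
    intro i j hij u hu v hv
    simp only [block, Finset.coe_Ioc, Set.mem_Ioc] at hu hv
    have h1 : (i + 1) * L ≤ j * L := Nat.mul_le_mul_right _ hij
    have h2 : (i + 1) * L = i * L + L := by ring
    rw [abs_sub_comm]
    refine le_trans ?_ (le_abs_self _)
    push_cast [Nat.cast_sub hl] at *
    omega
  rcases lt_or_gt_of_ne hij with h | h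
  · exact key i j h
  · exact (key j i h).symm

lemma card_block (L l j : ℕ) : (block L l j).card = l := by
  simp [block]

lemma block_eq_map (L l j : ℕ) :
    block L l j = (Finset.Ioc (0 : ℤ) l).map (addRightEmbedding ((j * L : ℕ) : ℤ)) := by
  rw [Finset.map_add_right_Ioc, block]
  congr 1 <;> push_cast <;> ring

lemma pairwiseDisjoint_block {L l : ℕ} (hl : l < L) (s : Set ℕ) :
    s.PairwiseDisjoint (block L l) := by
  intro i _ j _ hij
  rw [Function.onFun, ← Finset.disjoint_coe]
  exact (separated_block hl.le hij).disjoint (by omega)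

lemma biUnion_block_subset {L l k n : ℕ} (hl : l ≤ L) (hk : k * L ≤ n) :
    (Finset.range k).biUnion (block L l) ⊆ Finset.Ioc (0 : ℤ) n := by
  intro i hi
  simp only [Finset.mem_biUnion, Finset.mem_range, block, Finset.mem_Ioc] at hi ⊢
  obtain ⟨j, hj, h1, h2⟩ := hi
  have h3 : (j + 1) * L ≤ k * L := Nat.mul_le_mul_right _ hj
  have h4 : (j + 1) * L = j * L + L := by ring
  constructor <;> omega

/-- The integers of `(0, n]` outside the first `k` blocks. -/
noncomputable def blockGap (L l k n : ℕ) : Finset ℤ :=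
  Finset.Ioc (0 : ℤ) n \ (Finset.range k).biUnion (block L l)

lemma card_blockGap {L l k n : ℕ} (hl : l < L) (hk : k * L ≤ n) :
    (blockGap L l k n).card = n - k * l := by
  rw [blockGap, Finset.card_sdiff_of_subset (biUnion_block_subset hl.le hk),
    Finset.card_biUnion (pairwiseDisjoint_block hl _)]
  simp [card_block]

lemma sum_eq_sum_block_add {M : Type*} [AddCommMonoid M] (x : ℤ → M) {L l k n : ℕ} (hl : l < L)
    (hk : k * L ≤ n) :
    ∑ i ∈ Finset.Ioc (0 : ℤ) n, x i =
      ∑ j ∈ Finset.range k, ∑ i ∈ block L l j, x i + ∑ i ∈ blockGap L l k n, x i := by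
  rw [← Finset.sum_biUnion (pairwiseDisjoint_block hl _), blockGap, add_comm,
    Finset.sum_sdiff (biUnion_block_subset hl.le hk)]

/-! ### Almost subadditive variance in a Hilbert space -/

section Hilbert

variable {H : Type*} [NormedAddCommGroup H] [InnerProductSpace ℝ H]

/-- Signs are chosen greedily: each new vector gets the sign that makes its inner product with the
current signed sum nonpositive, so no cross term ever increases the norm. The set `t` collects the
plus signs. -/
lemma exists_norm_sum_sub_sum_sq_le {ι : Type*} [DecidableEq ι] (y : ι → H) (s : Finset ι) :
    ∃ t ⊆ s, ‖∑ i ∈ t, y i - ∑ i ∈ s \ t, y i‖ ^ 2 ≤ ∑ i ∈ s, ‖y i‖ ^ 2 := by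
  induction s using Finset.induction_on with
  | empty => exact ⟨∅, by simp, by simp⟩
  | insert a s ha ih =>
    obtain ⟨t, hts, ht⟩ := ih
    have hat : a ∉ t := fun h => ha (hts h)
    rw [Finset.sum_insert ha]
    rcases le_total (⟪∑ i ∈ t, y i - ∑ i ∈ s \ t, y i, y a⟫_ℝ) 0 with h | h
    · refine ⟨insert a t, Finset.insert_subset_insert _ hts, ?_⟩
      have hs : insert a s \ insert a t = s \ t := by
        rw [Finset.insert_sdiff_insert, Finset.sdiff_insert_of_notMem ha]
      rw [hs, Finset.sum_insert hat]
      have e : y a + ∑ i ∈ t, y i - ∑ i ∈ s \ t, y i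
          = (∑ i ∈ t, y i - ∑ i ∈ s \ t, y i) + y a := by abel
      rw [e, norm_add_sq_real]
      linarith
    · refine ⟨t, hts.trans (Finset.subset_insert _ _), ?_⟩
      rw [Finset.insert_sdiff_of_notMem _ hat,
        Finset.sum_insert (fun h => ha (Finset.mem_sdiff.1 h).1)]
      have e : ∑ i ∈ t, y i - (y a + ∑ i ∈ s \ t, y i)
          = (∑ i ∈ t, y i - ∑ i ∈ s \ t, y i) - y a := by abel
      rw [e, norm_sub_sq_real]
      linarith

/-- With a and b the plus and minus groups of a good choice of signs, 2|⟨a, b⟩| ≤ r(‖a‖² + ‖b‖²). So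
‖a - b‖² is at least (1 - r)(‖a‖² + ‖b‖²) and ‖a + b‖² at most (1 + r)(‖a‖² + ‖b‖²). -/
lemma norm_sum_sq_le_of_forall_subset {ι : Type*} [DecidableEq ι] {y : ι → H} {s : Finset ι}
    {r : ℝ} (hr0 : 0 ≤ r) (hr1 : r < 1)
    (h : ∀ t ⊆ s, |⟪∑ i ∈ t, y i, ∑ i ∈ s \ t, y i⟫_ℝ|
      ≤ r * ‖∑ i ∈ t, y i‖ * ‖∑ i ∈ s \ t, y i‖) :
    ‖∑ i ∈ s, y i‖ ^ 2 ≤ (1 + r) / (1 - r) * ∑ i ∈ s, ‖y i‖ ^ 2 := by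
  obtain ⟨t, hts, ht⟩ := exists_norm_sum_sub_sum_sq_le y s
  have hin := h t hts
  rw [← Finset.sum_sdiff hts, add_comm]
  set a := ∑ i ∈ t, y i
  set b := ∑ i ∈ s \ t, y i
  rw [norm_sub_sq_real] at ht
  rw [norm_add_sq_real, div_mul_eq_mul_div, le_div_iff₀ (by linarith)]
  have hab : r * ‖a‖ * ‖b‖ ≤ r * ((‖a‖ ^ 2 + ‖b‖ ^ 2) / 2) := by
    rw [mul_assoc]
    exact mul_le_mul_of_nonneg_left (by nlinarith [sq_nonneg (‖a‖ - ‖b‖)]) hr0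
  obtain ⟨h1, h2⟩ := abs_le.1 hin
  set N := ‖a‖ ^ 2 + ‖b‖ ^ 2
  have hN : (1 - r) * N ≤ ∑ i ∈ s, ‖y i‖ ^ 2 := by linarith
  have h3 : ‖a‖ ^ 2 + 2 * ⟪a, b⟫_ℝ + ‖b‖ ^ 2 ≤ (1 + r) * N := by linarith
  nlinarith

/-- The partial sums of `x` over `p`-separated finite sets have correlation at most `r`. -/
def CorrLe (x : ℤ → H) (p : ℕ) (r : ℝ) : Prop :=
  ∀ s t : Finset ℤ, Separated p (s : Set ℤ) t →
    |⟪∑ i ∈ s, x i, ∑ i ∈ t, x i⟫_ℝ| ≤ r * ‖∑ i ∈ s, x i‖ * ‖∑ i ∈ t, x i‖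

/-- The sign choice gives no control over which blocks go to which group, so the two unions are
interlaced in general; they are still `p`-separated. -/
lemma CorrLe.norm_sum_block_sq_le {x : ℤ → H} {p : ℕ} {r : ℝ} (hx : CorrLe x p r) (hp : 1 ≤ p)
    (hr0 : 0 ≤ r) (hr1 : r < 1) {ι : Type*} [DecidableEq ι] (b : ι → Finset ℤ) (s : Finset ι)
    (hb : ∀ i ∈ s, ∀ j ∈ s, i ≠ j → Separated p (b i : Set ℤ) (b j)) :
    ‖∑ j ∈ s, ∑ i ∈ b j, x i‖ ^ 2 ≤ (1 + r) / (1 - r) * ∑ j ∈ s, ‖∑ i ∈ b j, x i‖ ^ 2 := by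
  refine norm_sum_sq_le_of_forall_subset hr0 hr1 fun t hts => ?_
  have hd : ∀ u ⊆ s, (u : Set ι).PairwiseDisjoint b := fun u hu i hi j hj hij => by
    rw [Function.onFun, ← Finset.disjoint_coe]
    exact (hb i (hu hi) j (hu hj) hij).disjoint hp
  rw [← Finset.sum_biUnion (hd t hts), ← Finset.sum_biUnion (hd (s \ t) Finset.sdiff_subset)]
  refine hx _ _ (Separated.biUnion fun i hi j hj => ?_)
  rw [Finset.mem_sdiff] at hj
  exact hb i (hts hi) j hj.1 (fun h => hj.2 (h ▸ hi))

lemma CorrLe.norm_sum_sq_le_of_isSpaced {x : ℤ → H} {p : ℕ} {r : ℝ} (hx : CorrLe x p r)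
    (hp : 1 ≤ p) (hr0 : 0 ≤ r) (hr1 : r < 1) {K : ℝ} (hK : ∀ i, ‖x i‖ ^ 2 ≤ K) (s : Finset ℤ)
    (hs : IsSpaced p (s : Set ℤ)) :
    ‖∑ i ∈ s, x i‖ ^ 2 ≤ (1 + r) / (1 - r) * K * s.card := by
  have h := hx.norm_sum_block_sq_le hp hr0 hr1 (fun i => {i}) s
    (fun i hi j hj hij u hu v hv => by
      simp only [Finset.coe_singleton, Set.mem_singleton_iff] at hu hv
      rw [hu, hv]; exact hs i hi j hj hij)
  simp only [Finset.sum_singleton] at h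
  refine h.trans ?_
  rw [mul_assoc]
  refine mul_le_mul_of_nonneg_left ?_ (div_nonneg (by linarith) (by linarith))
  refine (Finset.sum_le_card_nsmul _ _ K fun i _ => hK i).trans_eq ?_
  rw [nsmul_eq_mul, mul_comm]

lemma emod_mem_Ico {p : ℕ} (hp : 1 ≤ p) (s : Finset ℤ) :
    ∀ i ∈ s, i % (p : ℤ) ∈ Finset.Ico (0 : ℤ) p := fun i _ => by
  have : (0 : ℤ) < p := by exact_mod_cast hp
  exact Finset.mem_Ico.2 ⟨Int.emod_nonneg _ this.ne', Int.emod_lt_of_pos _ this⟩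

/-- Each residue class mod `p` is spaced; adding the `p` classes by Cauchy–Schwarz costs the factor
`p`. -/
lemma CorrLe.norm_sum_sq_le {x : ℤ → H} {p : ℕ} {r : ℝ} (hx : CorrLe x p r)
    (hp : 1 ≤ p) (hr0 : 0 ≤ r) (hr1 : r < 1) {K : ℝ} (hK : ∀ i, ‖x i‖ ^ 2 ≤ K) (s : Finset ℤ) :
    ‖∑ i ∈ s, x i‖ ^ 2 ≤ p * ((1 + r) / (1 - r)) * K * s.card := by
  rw [← Finset.sum_fiberwise_of_maps_to (emod_mem_Ico hp s) x]
  have h1 : ‖∑ a ∈ Finset.Ico (0 : ℤ) p, ∑ i ∈ s with i % (p : ℤ) = a, x i‖ ^ 2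
      ≤ p * ∑ a ∈ Finset.Ico (0 : ℤ) p, ‖∑ i ∈ s with i % (p : ℤ) = a, x i‖ ^ 2 := by
    refine (pow_le_pow_left₀ (norm_nonneg _) (norm_sum_le _ _) 2).trans ?_
    refine (sq_sum_le_card_mul_sum_sq).trans_eq ?_
    simp
  refine h1.trans ?_
  rw [mul_assoc, mul_assoc]
  refine mul_le_mul_of_nonneg_left ?_ (Nat.cast_nonneg _)
  rw [Finset.card_eq_sum_card_fiberwise (emod_mem_Ico hp s), ← mul_assoc]
  push_cast
  rw [Finset.mul_sum]
  exact Finset.sum_le_sum fun a _ => hx.norm_sum_sq_le_of_isSpaced hp hr0 hr1 hK _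
    (isSpaced_filter_emod p s a)

end Hilbert

/-! ### Convergence of the normalized norms -/

section HilbertLimit

variable {H : Type*} [NormedAddCommGroup H] [InnerProductSpace ℝ H]

lemma sum_block_shift {M : Type*} [AddCommMonoid M] (x : ℤ → M) (L l j : ℕ) :
    ∑ i ∈ block L l j, x i = ∑ i ∈ Finset.Ioc (0 : ℤ) l, x (i + ((j * L : ℕ) : ℤ)) := by
  rw [block_eq_map, Finset.sum_map]
  rfl

/-- The interval (0, n] is cut into k = n / (m + p) blocks of length m followed by gaps of length p.
The blocks obey almost subadditivity with equal norms by stationarity; the points left over are few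
and obey the linear bound. -/
lemma CorrLe.norm_sum_div_sqrt_le {x : ℤ → H} {p : ℕ} {r : ℝ} (hx : CorrLe x p r)
    (hstat : ∀ (s : Finset ℤ) (j : ℕ), ‖∑ i ∈ s, x (i + j)‖ = ‖∑ i ∈ s, x i‖)
    (hp : 1 ≤ p) (hr0 : 0 ≤ r) (hr1 : r < 1) {c : ℝ} (hc0 : 0 ≤ c)
    (hc : ∀ s : Finset ℤ, ‖∑ i ∈ s, x i‖ ^ 2 ≤ c ^ 2 * s.card)
    {m n : ℕ} (hm : 1 ≤ m) (hn : 1 ≤ n) :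
    ‖∑ i ∈ Finset.Ioc (0 : ℤ) n, x i‖ / √n ≤
      √((1 + r) / (1 - r)) * (‖∑ i ∈ Finset.Ioc (0 : ℤ) m, x i‖ / √m) +
        c * √(p / m + (m + p) / n) := by
  set L := m + p with hL
  set k := n / L with hk
  have hkL : k * L ≤ n := Nat.div_mul_le_self n L
  have hlL : m < L := by omega
  have hn' : (0 : ℝ) < n := by exact_mod_cast hn
  have hm' : (0 : ℝ) < m := by exact_mod_cast hm
  have hL' : (0 : ℝ) < L := by exact_mod_cast (by omega : 0 < L)
  have hkap : 0 ≤ (1 + r) / (1 - r) := div_nonneg (by linarith) (by linarith)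
  have hblk : ‖∑ j ∈ Finset.range k, ∑ i ∈ block L m j, x i‖
      ≤ √((1 + r) / (1 - r)) * (√k * ‖∑ i ∈ Finset.Ioc (0 : ℤ) m, x i‖) := by
    have h := hx.norm_sum_block_sq_le hp hr0 hr1 (block L m) (Finset.range k)
      (fun i _ j _ hij => (separated_block hlL.le hij).of_le (by omega))
    have h2 : ∀ j, ‖∑ i ∈ block L m j, x i‖ = ‖∑ i ∈ Finset.Ioc (0 : ℤ) m, x i‖ := fun j => by
      rw [sum_block_shift, hstat]
    simp only [h2, Finset.sum_const, Finset.card_range, nsmul_eq_mul] at h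
    refine le_of_sq_le_sq ?_ (by positivity)
    rw [mul_pow, mul_pow, Real.sq_sqrt hkap, Real.sq_sqrt (Nat.cast_nonneg _)]
    exact h
  have hgap : ‖∑ i ∈ blockGap L m k n, x i‖ ≤ c * √((n : ℝ) - k * m) := by
    have h := hc (blockGap L m k n)
    have hle : k * m ≤ n := (Nat.mul_le_mul_left k hlL.le).trans hkL
    rw [card_blockGap hlL hkL, Nat.cast_sub hle, Nat.cast_mul] at h
    refine le_of_sq_le_sq ?_ (by positivity)
    rw [mul_pow, Real.sq_sqrt]
    · exact h
    · rw [sub_nonneg]; exact_mod_cast hle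
  have hsum := norm_add_le (∑ j ∈ Finset.range k, ∑ i ∈ block L m j, x i)
    (∑ i ∈ blockGap L m k n, x i)
  rw [← sum_eq_sum_block_add x hlL hkL] at hsum
  have hkm : (k : ℝ) * m ≤ n := by
    exact_mod_cast (Nat.mul_le_mul_left k hlL.le).trans hkL
  have h1 : √k * ‖∑ i ∈ Finset.Ioc (0 : ℤ) m, x i‖ / √n
      ≤ ‖∑ i ∈ Finset.Ioc (0 : ℤ) m, x i‖ / √m := by
    rw [div_le_div_iff₀ (Real.sqrt_pos.2 hn') (Real.sqrt_pos.2 hm'), mul_assoc, mul_comm _ (√(m:ℝ)),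
      ← mul_assoc, ← Real.sqrt_mul (Nat.cast_nonneg _), mul_comm]
    exact mul_le_mul_of_nonneg_left (Real.sqrt_le_sqrt hkm) (norm_nonneg _)
  have h2 : √((n : ℝ) - k * m) / √n ≤ √(p / m + (m + p) / n) := by
    rw [← Real.sqrt_div' _ hn'.le]
    refine Real.sqrt_le_sqrt ?_
    have hnk : n < k * L + L := by
      have := Nat.lt_div_mul_add (a := n) (b := L) (by omega)
      simpa [hk] using this
    -- The points outside the blocks lie in the k gaps of length p or in the incomplete last period.
    have hnk' : (n : ℝ) ≤ k * m + k * p + (m + p) := by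
      have : (n : ℝ) < k * L + L := by exact_mod_cast hnk
      rw [hL] at this; push_cast at this; linarith
    have h3 : (n : ℝ) - k * m ≤ k * p + (m + p) := by linarith
    have h4 : (k : ℝ) * p / n ≤ p / m := by
      rw [div_le_div_iff₀ hn' hm']
      have : (k : ℝ) * p * m = (k * m) * p := by ring
      rw [this, mul_comm (p : ℝ)]
      exact mul_le_mul_of_nonneg_right hkm (Nat.cast_nonneg _)
    calc ((n : ℝ) - k * m) / n ≤ (k * p + (m + p)) / n := by gcongr
      _ = k * p / n + (m + p) / n := add_div _ _ _
      _ ≤ _ := by gcongr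
  calc ‖∑ i ∈ Finset.Ioc (0 : ℤ) n, x i‖ / √n
      ≤ (√((1 + r) / (1 - r)) * (√k * ‖∑ i ∈ Finset.Ioc (0 : ℤ) m, x i‖)
          + c * √((n : ℝ) - k * m)) / √n := by gcongr; linarith
    _ = √((1 + r) / (1 - r)) * (√k * ‖∑ i ∈ Finset.Ioc (0 : ℤ) m, x i‖ / √n)
          + c * (√((n : ℝ) - k * m) / √n) := by ring
    _ ≤ _ := by gcongr

lemma exists_corr_factor_lt {a b : ℝ} (hab : a < b) :
    ∃ r : ℝ, 0 < r ∧ r < 1 ∧ √((1 + r) / (1 - r)) * a < b := by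
  have hc : ContinuousAt (fun r : ℝ => √((1 + r) / (1 - r)) * a) 0 := by
    refine ContinuousAt.mul (Real.continuous_sqrt.continuousAt.comp ?_) continuousAt_const
    exact ContinuousAt.div (by fun_prop) (by fun_prop) (by norm_num)
  have h1 : ∀ᶠ r in 𝓝 (0 : ℝ), √((1 + r) / (1 - r)) * a < b :=
    hc.eventually_lt continuousAt_const (by simpa using hab)
  have h2 : ∀ᶠ r in 𝓝[>] (0 : ℝ), √((1 + r) / (1 - r)) * a < b := h1.filter_mono nhdsWithin_le_nhds
  obtain ⟨r, hr, hr0, hr1⟩ := (h2.and (Ioo_mem_nhdsGT (zero_lt_one' ℝ))).exists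
  exact ⟨r, hr0, hr1, hr⟩

theorem tendsto_norm_sum_div_sqrt (x : ℤ → H)
    (hstat : ∀ (s : Finset ℤ) (j : ℕ), ‖∑ i ∈ s, x (i + j)‖ = ‖∑ i ∈ s, x i‖)
    (hmix : ∀ ε > 0, ∃ p, 1 ≤ p ∧ CorrLe x p ε)
    {c : ℝ} (hc0 : 0 ≤ c) (hc : ∀ s : Finset ℤ, ‖∑ i ∈ s, x i‖ ^ 2 ≤ c ^ 2 * s.card) :
    ∃ v : ℝ, Tendsto (fun n : ℕ => ‖∑ i ∈ Finset.Ioc (0 : ℤ) n, x i‖ / √n) atTop (𝓝 v) := by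
  set a : ℕ → ℝ := fun n => ‖∑ i ∈ Finset.Ioc (0 : ℤ) n, x i‖ / √n with ha
  have ha0 : ∀ n, 0 ≤ a n := fun n => by positivity
  have hac : ∀ n, a n ≤ c := fun n => by
    rcases Nat.eq_zero_or_pos n with rfl | hn
    · simpa [ha] using hc0
    · have hn' : (0 : ℝ) < √n := Real.sqrt_pos.2 (by exact_mod_cast hn)
      rw [ha, div_le_iff₀ hn']
      refine le_of_sq_le_sq ?_ (by positivity)
      rw [mul_pow, Real.sq_sqrt (Nat.cast_nonneg _)]
      simpa using hc (Finset.Ioc (0 : ℤ) n)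
  have hbdd1 : IsBoundedUnder (· ≤ ·) atTop a := ⟨c, by simpa using ⟨0, fun n _ => hac n⟩⟩
  have hbdd2 : IsBoundedUnder (· ≥ ·) atTop a := ⟨0, by simpa using ⟨0, fun n _ => ha0 n⟩⟩
  refine ⟨liminf a atTop, tendsto_of_le_liminf_of_limsup_le le_rfl ?_ hbdd1 hbdd2⟩
  set l := liminf a atTop
  refine le_of_forall_pos_le_add fun ε hε => ?_
  obtain ⟨r, hr0, hr1, hr⟩ := exists_corr_factor_lt (show l + ε / 4 < l + ε / 2 by linarith)
  obtain ⟨p, hp, hcorr⟩ := hmix r hr0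
  have hfr : ∃ᶠ m in atTop, a m < l + ε / 4 :=
    frequently_lt_of_liminf_lt (hbdd1.isCoboundedUnder_ge) (by linarith)
  have hev : ∀ᶠ m : ℕ in atTop, c * √((p : ℝ) / m + (p : ℝ) / m) < ε / 2 := by
    have h1 : Tendsto (fun m : ℕ => (p : ℝ) / m) atTop (𝓝 0) :=
      tendsto_const_div_atTop_nhds_zero_nat _
    have h2 := ((Real.continuous_sqrt.tendsto _).comp (h1.add h1)).const_mul c
    simp only [add_zero, Real.sqrt_zero, mul_zero] at h2
    exact h2.eventually_lt_const (by linarith)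
  -- The ratio at m must be near the liminf, which happens only for infinitely many m, and m must
  -- also be large compared with the p already fixed by r.
  obtain ⟨m, hml, hme, hm1⟩ := (hfr.and_eventually (hev.and (eventually_ge_atTop 1))).exists
  have hm' : (0 : ℝ) < m := by exact_mod_cast hm1
  have hp' : (0 : ℝ) < p := by exact_mod_cast hp
  have hn : ∀ᶠ n : ℕ in atTop, ((m : ℝ) + p) / n ≤ p / m := by
    have h1 : Tendsto (fun n : ℕ => ((m : ℝ) + p) / n) atTop (𝓝 0) :=
      tendsto_const_div_atTop_nhds_zero_nat _
    exact h1.eventually_le_const (by positivity)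
  refine limsup_le_of_le (hbdd2.isCoboundedUnder_le) ?_
  filter_upwards [hn, eventually_ge_atTop 1] with n hn hn1
  have h := hcorr.norm_sum_div_sqrt_le hstat hp hr0.le hr1 hc0 hc hm1 hn1
  have h3 : √((1 + r) / (1 - r)) * a m ≤ √((1 + r) / (1 - r)) * (l + ε / 4) := by gcongr
  have h4 : c * √((p : ℝ) / m + ((m : ℝ) + p) / n) ≤ c * √((p : ℝ) / m + (p : ℝ) / m) := by gcongr
  change a n ≤ _
  linarith

end HilbertLimit

/-! ### Second moments as norms in L² -/

section L2

variable {Ω : Type*} [MeasurableSpace Ω] {P : Measure Ω}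

lemma inner_toLp_toLp {X Y : Ω → ℝ} (hX : MemLp X 2 P) (hY : MemLp Y 2 P) :
    inner ℝ (hX.toLp X) (hY.toLp Y) = ∫ ω, X ω * Y ω ∂P := by
  rw [L2.inner_def]
  refine integral_congr_ae ?_
  filter_upwards [hX.coeFn_toLp, hY.coeFn_toLp] with ω h1 h2
  rw [h1, h2]
  simp [mul_comm]

lemma norm_toLp_sq {X : Ω → ℝ} (hX : MemLp X 2 P) :
    ‖hX.toLp X‖ ^ 2 = ∫ ω, X ω ^ 2 ∂P := by
  rw [← real_inner_self_eq_norm_sq, inner_toLp_toLp]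
  simp only [sq]

lemma norm_toLp_eq_sqrt {X : Ω → ℝ} (hX : MemLp X 2 P) :
    ‖hX.toLp X‖ = √(∫ ω, X ω ^ 2 ∂P) := by
  rw [← norm_toLp_sq hX, Real.sqrt_sq (norm_nonneg _)]

lemma l2Norm_eq_sqrt {X : Ω → ℝ} (hX : MemLp X 2 P) :
    l2Norm P X = √(∫ ω, X ω ^ 2 ∂P) := by
  rw [← norm_toLp_eq_sqrt hX, Lp.norm_toLp, l2Norm]

lemma integral_sq_nonneg (X : Ω → ℝ) : 0 ≤ ∫ ω, X ω ^ 2 ∂P :=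
  integral_nonneg fun _ => sq_nonneg _

lemma l2Norm_sq {X : Ω → ℝ} (hX : MemLp X 2 P) : l2Norm P X ^ 2 = ∫ ω, X ω ^ 2 ∂P := by
  rw [l2Norm_eq_sqrt hX, Real.sq_sqrt (integral_sq_nonneg X)]

lemma abs_sqrt_integral_sq_sub_le {X Y : Ω → ℝ} (hX : MemLp X 2 P) (hY : MemLp Y 2 P) :
    |√(∫ ω, X ω ^ 2 ∂P) - √(∫ ω, Y ω ^ 2 ∂P)| ≤ √(∫ ω, (X ω - Y ω) ^ 2 ∂P) := by
  have h := abs_norm_sub_norm_le (hX.toLp X) (hY.toLp Y)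
  rw [← MemLp.toLp_sub, norm_toLp_eq_sqrt, norm_toLp_eq_sqrt, norm_toLp_eq_sqrt] at h
  exact h

lemma abs_integral_mul_le_sqrt {X Y : Ω → ℝ} (hX : MemLp X 2 P) (hY : MemLp Y 2 P) :
    |∫ ω, X ω * Y ω ∂P| ≤ √(∫ ω, X ω ^ 2 ∂P) * √(∫ ω, Y ω ^ 2 ∂P) := by
  have h := abs_real_inner_le_norm (hX.toLp X) (hY.toLp Y)
  rwa [inner_toLp_toLp, norm_toLp_eq_sqrt, norm_toLp_eq_sqrt] at h

lemma integral_abs_le_sqrt_integral_sq [IsProbabilityMeasure P] {X : Ω → ℝ} (hX : MemLp X 2 P) :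
    ∫ ω, |X ω| ∂P ≤ √(∫ ω, X ω ^ 2 ∂P) := by
  have h := abs_integral_mul_le_sqrt hX.norm (memLp_const (1 : ℝ))
  simp only [Real.norm_eq_abs, mul_one, sq_abs, one_pow, integral_const, probReal_univ, smul_eq_mul,
    Real.sqrt_one] at h
  exact (le_abs_self _).trans h

end L2

/-! ### Covariance inequality, stationarity and linear variance growth -/

section PartialSums

lemma measurable_sigmaGen {Ω S : Type*} [mS : MeasurableSpace S] {ξ : ℤ → Ω → S} {I : Set ℤ} {i : ℤ}
    (hi : i ∈ I) : Measurable[sigmaGen ξ I] (ξ i) :=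
  Measurable.mono (comap_measurable (ξ i))
    (le_iSup₂ (f := fun i (_ : i ∈ I) => MeasurableSpace.comap (ξ i) mS) i hi) le_rfl

/-- The sum of `f (ξ_i)` over a finite set of indices. -/
noncomputable def sumOver {Ω S : Type*} (ξ : ℤ → Ω → S) (f : S → ℝ) (s : Finset ℤ) (ω : Ω) : ℝ :=
  ∑ i ∈ s, f (ξ i ω)

lemma measurable_sumOver_sigmaGen {Ω S : Type*} [MeasurableSpace S] {ξ : ℤ → Ω → S}
    {f : S → ℝ} (hf : Measurable f) {s : Finset ℤ} {I : Set ℤ}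
    (hs : (s : Set ℤ) ⊆ I) : Measurable[sigmaGen ξ I] (sumOver ξ f s) :=
  Finset.measurable_fun_sum s fun _ hi => hf.comp (measurable_sigmaGen (hs hi))

lemma partialSum_eq_sumOver {Ω S : Type*} {ξ : ℤ → Ω → S} (f : S → ℝ) (n : ℕ) :
    partialSum ξ f n = sumOver ξ f (Finset.Ioc (0 : ℤ) n) := by
  ext ω
  have h : Finset.Ioc (0 : ℤ) n = (Finset.Icc 1 n).map Nat.castEmbedding := by
    ext i
    simp only [Finset.mem_Ioc, Finset.mem_map, Finset.mem_Icc, Nat.castEmbedding_apply]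
    constructor
    · rintro ⟨h1, h2⟩
      exact ⟨i.toNat, by omega, by omega⟩
    · rintro ⟨j, h1, rfl⟩
      omega
  rw [partialSum, sumOver, h, Finset.sum_map]
  rfl

variable {Ω S : Type*} [mΩ : MeasurableSpace Ω] [mS : MeasurableSpace S] {P : Measure Ω}
  {ξ : ℤ → Ω → S}

lemma sigmaGen_le (hξ : ∀ k, Measurable (ξ k)) (I : Set ℤ) : sigmaGen ξ I ≤ mΩ :=
  iSup₂_le fun i _ => (hξ i).comap_le

lemma measurable_sumOver (hξ : ∀ k, Measurable (ξ k)) {f : S → ℝ} (hf : Measurable f)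
    (s : Finset ℤ) : Measurable (sumOver ξ f s) :=
  Finset.measurable_fun_sum s fun i _ => hf.comp (hξ i)

/-- Covariance bound with constant `r` for functions of variables with `p`-separated indices. -/
def CovLe (P : Measure Ω) (ξ : ℤ → Ω → S) (p : ℕ) (r : ℝ) : Prop :=
  ∀ I J : Set ℤ, Separated p I J → ∀ X Y : Ω → ℝ, Measurable[sigmaGen ξ I] X →
    Measurable[sigmaGen ξ J] Y → MemLp X 2 P → MemLp Y 2 P →
    |∫ ω, X ω * Y ω ∂P - (∫ ω, X ω ∂P) * ∫ ω, Y ω ∂P|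
      ≤ r * √(∫ ω, X ω ^ 2 ∂P) * √(∫ ω, Y ω ^ 2 ∂P)

lemma abs_integral_mul_le_of_rhoStar_le {p : ℕ} {r : ℝ} (hr : 0 ≤ r)
    (h : rhoStar P ξ p ≤ ENNReal.ofReal r) (hp : 1 ≤ p) {I J : Set ℤ} (hI : I.Nonempty)
    (hJ : J.Nonempty) (hIJ : Separated p I J) {X Y : Ω → ℝ} (hX : MemL20 (sigmaGen ξ I) P X)
    (hY : MemL20 (sigmaGen ξ J) P Y) :
    |∫ ω, X ω * Y ω ∂P| ≤ r * √(∫ ω, X ω ^ 2 ∂P) * √(∫ ω, Y ω ^ 2 ∂P) := by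
  have h1 : ENNReal.ofReal (|∫ ω, X ω * Y ω ∂P| / (l2Norm P X * l2Norm P Y))
      ≤ ENNReal.ofReal r := by
    refine le_trans ?_ h
    have hc : ENNReal.ofReal (|∫ ω, X ω * Y ω ∂P| / (l2Norm P X * l2Norm P Y))
        ≤ maxCorr (sigmaGen ξ I) (sigmaGen ξ J) P :=
      le_iSup₂_of_le X hX (le_iSup₂_of_le Y hY le_rfl)
    exact le_iSup_of_le I <| le_iSup_of_le J <| le_iSup_of_le hI <| le_iSup_of_le hJ <|
      le_iSup_of_le (hIJ.disjoint hp) <| le_iSup_of_le hIJ hc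
  rw [ENNReal.ofReal_le_ofReal_iff hr, l2Norm_eq_sqrt hX.2.1, l2Norm_eq_sqrt hY.2.1] at h1
  have hcs := abs_integral_mul_le_sqrt hX.2.1 hY.2.1
  -- If a norm vanishes the quotient is the default value 0 and carries no information;
  -- Cauchy–Schwarz then gives a zero integral.
  rcases (mul_nonneg (Real.sqrt_nonneg (∫ ω, X ω ^ 2 ∂P))
    (Real.sqrt_nonneg (∫ ω, Y ω ^ 2 ∂P))).eq_or_lt with h0 | h0
  · rw [mul_assoc, ← h0, mul_zero]
    rwa [← h0] at hcs
  · rwa [div_le_iff₀ h0, ← mul_assoc] at h1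

lemma memL20_sub_integral [IsProbabilityMeasure P] {I : Set ℤ} {X : Ω → ℝ}
    (hX : Measurable[sigmaGen ξ I] X) (hX2 : MemLp X 2 P) :
    MemL20 (sigmaGen ξ I) P (fun ω => X ω - ∫ ω, X ω ∂P) := by
  refine ⟨hX.sub_const _, hX2.sub (memLp_const _), ?_⟩
  rw [integral_sub (hX2.integrable (by norm_num)) (integrable_const _)]
  simp

lemma integral_sub_integral_sq_le [IsProbabilityMeasure P] {X : Ω → ℝ} (hX2 : MemLp X 2 P) :
    ∫ ω, (X ω - ∫ ω, X ω ∂P) ^ 2 ∂P ≤ ∫ ω, X ω ^ 2 ∂P := by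
  rw [← variance_eq_integral hX2.1.aemeasurable]
  simpa using variance_le_expectation_sq hX2.1

/-- Centring reduces to the definition of the mixing coefficient and does not increase second
moments. The form without centring is what allows squares, cosines and sines as test functions
later. -/
lemma covLe_of_rhoStar_le [IsProbabilityMeasure P] {p : ℕ} {r : ℝ}
    (hr : 0 ≤ r) (h : rhoStar P ξ p ≤ ENNReal.ofReal r) (hp : 1 ≤ p) : CovLe P ξ p r := by
  intro I J hIJ X Y hX hY hX2 hY2
  have hnn : 0 ≤ r * √(∫ ω, X ω ^ 2 ∂P) * √(∫ ω, Y ω ^ 2 ∂P) := by positivity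
  -- Empty index sets are outside the supremum; there the function is constant and the covariance is
  -- zero.
  rcases I.eq_empty_or_nonempty with rfl | hI
  · have : sigmaGen ξ (∅ : Set ℤ) = ⊥ := by simp
    rw [this] at hX
    obtain ⟨c, hc⟩ := eq_const_of_measurable_bot hX
    simpa [hc, integral_const_mul] using hnn
  rcases J.eq_empty_or_nonempty with rfl | hJ
  · have : sigmaGen ξ (∅ : Set ℤ) = ⊥ := by simp
    rw [this] at hY
    obtain ⟨c, hc⟩ := eq_const_of_measurable_bot hY
    simpa [hc, integral_mul_const] using hnn
  have h1 := abs_integral_mul_le_of_rhoStar_le hr h hp hI hJ hIJ (memL20_sub_integral hX hX2)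
    (memL20_sub_integral hY hY2)
  have h2 : ∫ ω, (X ω - ∫ ω, X ω ∂P) * (Y ω - ∫ ω, Y ω ∂P) ∂P
      = ∫ ω, X ω * Y ω ∂P - (∫ ω, X ω ∂P) * ∫ ω, Y ω ∂P := by
    have := covariance_eq_sub hX2 hY2
    simpa [covariance] using this
  rw [h2] at h1
  exact h1.trans (mul_le_mul (mul_le_mul_of_nonneg_left
    (Real.sqrt_le_sqrt (integral_sub_integral_sq_le hX2)) hr)
    (Real.sqrt_le_sqrt (integral_sub_integral_sq_le hY2)) (Real.sqrt_nonneg _) (by positivity))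

lemma IsRhoStarMixing.exists_covLe [IsProbabilityMeasure P] (h : IsRhoStarMixing P ξ) {ε : ℝ}
    (hε : 0 < ε) : ∃ p, 1 ≤ p ∧ CovLe P ξ p ε := by
  have h1 : ∀ᶠ p in atTop, rhoStar P ξ p < ENNReal.ofReal ε :=
    h.eventually_lt_const (ENNReal.ofReal_pos.2 hε)
  obtain ⟨p, hp, hp1⟩ := (h1.and (eventually_ge_atTop 1)).exists
  exact ⟨p, hp1, covLe_of_rhoStar_le hε.le hp.le hp1⟩

lemma IsStationary.map_shift (hξ : ∀ k, Measurable (ξ k)) (h : IsStationary P ξ) (j : ℕ) :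
    P.map (fun ω (k : ℤ) => ξ (k + j) ω) = P.map (fun ω (k : ℤ) => ξ k ω) := by
  induction j with
  | zero => simp
  | succ j ih =>
    have hT : Measurable (fun (x : ℤ → S) (k : ℤ) => x (k + j)) :=
      measurable_pi_lambda _ fun k => measurable_pi_apply _
    have h1 := congrArg (Measure.map (fun (x : ℤ → S) (k : ℤ) => x (k + j))) h
    rw [Measure.map_map hT (measurable_pi_lambda _ fun k => hξ _),
      Measure.map_map hT (measurable_pi_lambda _ fun k => hξ _)] at h1
    rw [← ih]
    refine Eq.trans ?_ h1
    congr 1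
    ext ω k
    simp [Function.comp, add_assoc]

lemma IsStationary.identDistrib_shift (hξ : ∀ k, Measurable (ξ k)) (h : IsStationary P ξ) (j : ℕ) :
    IdentDistrib (fun ω (k : ℤ) => ξ (k + j) ω) (fun ω (k : ℤ) => ξ k ω) P P :=
  ⟨(measurable_pi_lambda _ fun _ => hξ _).aemeasurable,
    (measurable_pi_lambda _ fun _ => hξ _).aemeasurable, h.map_shift hξ j⟩

lemma IsStationary.identDistrib_eval (hξ : ∀ k, Measurable (ξ k)) (h : IsStationary P ξ) (i : ℤ) :
    IdentDistrib (ξ i) (ξ 0) P P := by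
  rcases Int.eq_nat_or_neg i with ⟨j, rfl | rfl⟩
  · simpa [Function.comp_def] using
      (h.identDistrib_shift hξ j).comp (measurable_pi_apply (0 : ℤ))
  · simpa [Function.comp_def] using
      ((h.identDistrib_shift hξ j).comp (measurable_pi_apply (-(j : ℤ)))).symm

lemma IsStationary.identDistrib_sumOver (hξ : ∀ k, Measurable (ξ k)) (h : IsStationary P ξ)
    {f : S → ℝ} (hf : Measurable f) (s : Finset ℤ) (j : ℕ) :
    IdentDistrib (fun ω => ∑ i ∈ s, f (ξ (i + j) ω)) (sumOver ξ f s) P P :=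
  (h.identDistrib_shift hξ j).comp (u := fun x : ℤ → S => ∑ i ∈ s, f (x i))
    (Finset.measurable_fun_sum s fun i _ => hf.comp (measurable_pi_apply i))

lemma IsStationary.identDistrib_block (hξ : ∀ k, Measurable (ξ k)) (h : IsStationary P ξ)
    {f : S → ℝ} (hf : Measurable f) (L l j : ℕ) :
    IdentDistrib (sumOver ξ f (block L l j)) (sumOver ξ f (Finset.Ioc (0 : ℤ) l)) P P := by
  convert! h.identDistrib_sumOver hξ hf (Finset.Ioc (0 : ℤ) l) (j * L) using 2 with ω
  exact sum_block_shift (fun i => f (ξ i ω)) L l j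

section Moments

variable (hξ : ∀ k, Measurable (ξ k)) (hstat : IsStationary P ξ)
  {f : S → ℝ} (hf : Measurable f)

include hξ hstat hf

lemma memLp_comp {q : ℝ≥0∞} (hf2 : MemLp (fun ω => f (ξ 0 ω)) q P) (i : ℤ) :
    MemLp (fun ω => f (ξ i ω)) q P :=
  (((hstat.identDistrib_eval hξ i).comp hf).memLp_iff).2 hf2

lemma memLp_sumOver {q : ℝ≥0∞} (hf2 : MemLp (fun ω => f (ξ 0 ω)) q P) (s : Finset ℤ) :
    MemLp (sumOver ξ f s) q P :=
  memLp_finsetSum s fun i _ => memLp_comp hξ hstat hf hf2 i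

lemma integral_sumOver_eq_zero [IsProbabilityMeasure P] (hf2 : MemLp (fun ω => f (ξ 0 ω)) 2 P)
    (hf0 : ∫ ω, f (ξ 0 ω) ∂P = 0) (s : Finset ℤ) : ∫ ω, sumOver ξ f s ω ∂P = 0 := by
  have h : ∀ i, ∫ ω, f (ξ i ω) ∂P = 0 := fun i =>
    (((hstat.identDistrib_eval hξ i).comp hf).integral_eq).trans hf0
  simp only [sumOver]
  rw [integral_finsetSum s fun i _ => (memLp_comp hξ hstat hf hf2 i).integrable (by norm_num)]
  simp [h]

lemma sum_toLp_eq (hf2 : MemLp (fun ω => f (ξ 0 ω)) 2 P) (s : Finset ℤ) :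
    ∑ i ∈ s, (memLp_comp hξ hstat hf hf2 i).toLp = (memLp_sumOver hξ hstat hf hf2 s).toLp := by
  induction s using Finset.induction_on with
  | empty =>
    refine (MemLp.toLp_zero MemLp.zero').symm.trans (MemLp.toLp_congr _ _ (ae_of_all _ fun ω => ?_))
    simp [sumOver]
  | insert a s ha ih =>
    rw [Finset.sum_insert ha, ih, ← MemLp.toLp_add]
    refine MemLp.toLp_congr _ _ (ae_of_all _ fun ω => ?_)
    simp [sumOver, Finset.sum_insert ha]

lemma corrLe_toLp [IsProbabilityMeasure P] (hf2 : MemLp (fun ω => f (ξ 0 ω)) 2 P)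
    (hf0 : ∫ ω, f (ξ 0 ω) ∂P = 0) {p : ℕ} {r : ℝ} (h : CovLe P ξ p r) :
    CorrLe (fun i => (memLp_comp hξ hstat hf hf2 i).toLp) p r := by
  intro s t hst
  rw [sum_toLp_eq hξ hstat hf hf2, sum_toLp_eq hξ hstat hf hf2, inner_toLp_toLp, norm_toLp_eq_sqrt,
    norm_toLp_eq_sqrt]
  have := h _ _ hst _ _ (measurable_sumOver_sigmaGen hf subset_rfl)
    (measurable_sumOver_sigmaGen hf subset_rfl) (memLp_sumOver hξ hstat hf hf2 s)
    (memLp_sumOver hξ hstat hf hf2 t)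
  rwa [integral_sumOver_eq_zero hξ hstat hf hf2 hf0, zero_mul, sub_zero] at this

/-- The 3 is (1 + r)/(1 - r) at r = 1/2. The gap `p` does not depend on `f`, so the bound is uniform
over functions with a given second moment, as the final approximation requires. -/
lemma integral_sumOver_sq_le [IsProbabilityMeasure P] (hf2 : MemLp (fun ω => f (ξ 0 ω)) 2 P)
    (hf0 : ∫ ω, f (ξ 0 ω) ∂P = 0) {p : ℕ} (hp : 1 ≤ p) (h : CovLe P ξ p (1 / 2))
    (s : Finset ℤ) :
    ∫ ω, sumOver ξ f s ω ^ 2 ∂P ≤ 3 * p * (∫ ω, f (ξ 0 ω) ^ 2 ∂P) * s.card := by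
  have h1 := (corrLe_toLp hξ hstat hf hf2 hf0 h).norm_sum_sq_le hp (by norm_num) (by norm_num)
    (K := ∫ ω, f (ξ 0 ω) ^ 2 ∂P) (fun i => by
      rw [norm_toLp_sq]
      exact ((hstat.identDistrib_eval hξ i).comp (hf.pow_const 2)).integral_eq.le) s
  rw [sum_toLp_eq hξ hstat hf hf2, norm_toLp_sq] at h1
  refine h1.trans_eq ?_
  ring

theorem tendsto_sqrt_integral_sq_div [IsProbabilityMeasure P]
    (hf2 : MemLp (fun ω => f (ξ 0 ω)) 2 P)
    (hf0 : ∫ ω, f (ξ 0 ω) ∂P = 0) (hmix : IsRhoStarMixing P ξ) :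
    ∃ v : ℝ, Tendsto (fun n : ℕ => √(∫ ω, sumOver ξ f (Finset.Ioc (0 : ℤ) n) ω ^ 2 ∂P) / √n)
      atTop (𝓝 v) := by
  obtain ⟨p, hp, hcov⟩ := hmix.exists_covLe (ε := 1 / 2) (by norm_num)
  have hK : 0 ≤ ∫ ω, f (ξ 0 ω) ^ 2 ∂P := integral_sq_nonneg _
  have h := tendsto_norm_sum_div_sqrt (fun i => (memLp_comp hξ hstat hf hf2 i).toLp)
    (fun s j => ?_) (fun ε hε => ?_) (c := √(3 * p * ∫ ω, f (ξ 0 ω) ^ 2 ∂P)) (by positivity)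
    (fun s => ?_)
  · simpa only [sum_toLp_eq hξ hstat hf hf2, norm_toLp_eq_sqrt] using h
  · have e : ∑ i ∈ s, (memLp_comp hξ hstat hf hf2 (i + j)).toLp
        = (((hstat.identDistrib_sumOver hξ hf s j).memLp_iff).2
            (memLp_sumOver hξ hstat hf hf2 s)).toLp := by
      have := sum_toLp_eq hξ hstat hf hf2 (s.map (addRightEmbedding (j : ℤ)))
      rw [Finset.sum_map] at this
      refine this.trans (MemLp.toLp_congr _ _ (ae_of_all _ fun ω => ?_))
      simp [sumOver]
    rw [e, sum_toLp_eq hξ hstat hf hf2, norm_toLp_eq_sqrt, norm_toLp_eq_sqrt]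
    congr 1
    exact ((hstat.identDistrib_sumOver hξ hf s j).comp
      (measurable_id.pow_const 2)).integral_eq
  · obtain ⟨q, hq, hq2⟩ := hmix.exists_covLe hε
    exact ⟨q, hq, corrLe_toLp hξ hstat hf hf2 hf0 hq2⟩
  · rw [sum_toLp_eq hξ hstat hf hf2, norm_toLp_sq, Real.sq_sqrt (by positivity)]
    exact integral_sumOver_sq_le hξ hstat hf hf2 hf0 hp hcov s

end Moments

end PartialSums

/-! ### Conditional expectation as an orthogonal projection -/

section CondExp

variable {Ω : Type*} {m mΩ : MeasurableSpace Ω} {P : Measure Ω} [IsProbabilityMeasure P]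

lemma integral_condExp_mul_self (hm : m ≤ mΩ) {X : Ω → ℝ}
    (hX : MemLp X 2 P) : ∫ ω, (P[X|m]) ω * X ω ∂P = ∫ ω, (P[X|m]) ω ^ 2 ∂P := by
  have hV : MemLp (P[X|m]) 2 P := hX.condExp (by norm_num)
  have h := condExp_mul_of_stronglyMeasurable_left (μ := P) (m := m) (f := P[X|m]) (g := X)
    stronglyMeasurable_condExp (hV.integrable_mul hX) (hX.integrable (by norm_num))
  have h2 := integral_congr_ae h
  rw [integral_condExp hm] at h2
  refine h2.trans (integral_congr_ae (ae_of_all _ fun ω => ?_))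
  simp [sq]

lemma integral_sub_condExp_sq (hm : m ≤ mΩ) {X : Ω → ℝ}
    (hX : MemLp X 2 P) :
    ∫ ω, (X ω - (P[X|m]) ω) ^ 2 ∂P = ∫ ω, X ω ^ 2 ∂P - ∫ ω, (P[X|m]) ω ^ 2 ∂P := by
  have hV : MemLp (P[X|m]) 2 P := hX.condExp (by norm_num)
  have e : ∀ ω, (X ω - (P[X|m]) ω) ^ 2
      = X ω ^ 2 - 2 * ((P[X|m]) ω * X ω) + (P[X|m]) ω ^ 2 := fun ω => by ring
  have hVX : Integrable (fun ω => (P[X|m]) ω * X ω) P := hV.integrable_mul hX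
  have hd : Integrable (fun ω => X ω ^ 2 - 2 * ((P[X|m]) ω * X ω)) P :=
    hX.integrable_sq.sub (hVX.const_mul 2)
  simp_rw [e]
  rw [integral_add hd hV.integrable_sq,
    integral_sub hX.integrable_sq (hVX.const_mul 2), integral_const_mul,
    integral_condExp_mul_self hm hX]
  ring

end CondExp

/-! ### Negligibility of the conditional mean -/

section PartialSums

variable {Ω S : Type*} [mΩ : MeasurableSpace Ω] [mS : MeasurableSpace S] {P : Measure Ω}
  {ξ : ℤ → Ω → S} (hξ : ∀ k, Measurable (ξ k))
  (hstat : IsStationary P ξ) {f : S → ℝ} (hf : Measurable f)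
  (hf2 : MemLp (fun ω => f (ξ 0 ω)) 2 P) (hf0 : ∫ ω, f (ξ 0 ω) ∂P = 0)

lemma sumOver_add_sumOver_sdiff {Ω S : Type*} (ξ : ℤ → Ω → S) (f : S → ℝ) {s t : Finset ℤ}
    (h : t ⊆ s) (ω : Ω) : sumOver ξ f s ω = sumOver ξ f t ω + sumOver ξ f (s \ t) ω := by
  rw [add_comm]
  exact (Finset.sum_sdiff h).symm

include hξ hstat hf hf2

lemma memLp_condMean (n : ℕ) : MemLp (condMean P ξ f n) 2 P := by
  rw [condMean, partialSum_eq_sumOver]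
  exact (memLp_sumOver hξ hstat hf hf2 _).condExp (by norm_num)

include hf0

variable [IsProbabilityMeasure P]

/-- Write ‖V‖² = E(V S_n) and split S_n. The middle part is almost uncorrelated with V, which
depends on ξ_0 and ξ_n only; the edges have at most 2p terms. Dividing by ‖V‖ gives the bound. -/
lemma sqrt_integral_condMean_sq_le {p : ℕ} {r : ℝ} (hr : 0 ≤ r) (hcov : CovLe P ξ p r) {c : ℝ}
    (hc0 : 0 ≤ c) (hc : ∀ s : Finset ℤ, ∫ ω, sumOver ξ f s ω ^ 2 ∂P ≤ c ^ 2 * s.card) {n : ℕ}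
    (hn : 2 * p ≤ n) :
    √(∫ ω, condMean P ξ f n ω ^ 2 ∂P) ≤ r * (c * √n) + c * √(2 * p) := by
  set V := condMean P ξ f n with hVdef
  have hV : MemLp V 2 P := memLp_condMean hξ hstat hf hf2 n
  set M : Finset ℤ := Finset.Ioc (p : ℤ) ((n : ℤ) - p) with hM
  have hMs : M ⊆ Finset.Ioc (0 : ℤ) n := Finset.Ioc_subset_Ioc (by omega) (by omega)
  have hL : ∀ s, MemLp (sumOver ξ f s) 2 P := memLp_sumOver hξ hstat hf hf2
  have hVS : ∫ ω, V ω ^ 2 ∂P = ∫ ω, V ω * sumOver ξ f M ω ∂P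
      + ∫ ω, V ω * sumOver ξ f (Finset.Ioc (0 : ℤ) n \ M) ω ∂P := by
    have hi : ∀ s, Integrable (fun ω => V ω * sumOver ξ f s ω) P := fun s =>
      hV.integrable_mul (hL s)
    rw [← integral_add (hi _) (hi _)]
    have h := integral_condExp_mul_self (P := P) (sigmaGen_le hξ {0, (n : ℤ)})
      (hL (Finset.Ioc (0 : ℤ) n))
    rw [← partialSum_eq_sumOver] at h
    refine Eq.trans h.symm (integral_congr_ae (ae_of_all _ fun ω => ?_))
    simp only [hVdef, condMean]
    rw [← mul_add, ← sumOver_add_sumOver_sdiff ξ f hMs, ← partialSum_eq_sumOver]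
  have hsep : Separated p {0, (n : ℤ)} (M : Set ℤ) := by
    intro i hi j hj
    simp only [hM, Finset.coe_Ioc, Set.mem_Ioc] at hj
    rcases hi with rfl | rfl
    · rw [abs_sub_comm]; exact le_trans (by omega) (le_abs_self _)
    · exact le_trans (by omega) (le_abs_self _)
  have h1 : ∫ ω, V ω * sumOver ξ f M ω ∂P
      ≤ r * √(∫ ω, V ω ^ 2 ∂P) * √(∫ ω, sumOver ξ f M ω ^ 2 ∂P) := by
    have h := hcov _ _ hsep V (sumOver ξ f M) stronglyMeasurable_condExp.measurable
      (measurable_sumOver_sigmaGen hf subset_rfl) hV (hL M)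
    rw [integral_sumOver_eq_zero hξ hstat hf hf2 hf0 M, mul_zero, sub_zero] at h
    exact (le_abs_self _).trans h
  have h2 := (le_abs_self _).trans (abs_integral_mul_le_sqrt hV (hL (Finset.Ioc (0 : ℤ) n \ M)))
  have hMb : √(∫ ω, sumOver ξ f M ω ^ 2 ∂P) ≤ c * √n := by
    rw [Real.sqrt_le_left (by positivity), mul_pow, Real.sq_sqrt (Nat.cast_nonneg _)]
    refine (hc M).trans (mul_le_mul_of_nonneg_left ?_ (sq_nonneg c))
    have := Finset.card_le_card hMs
    simp only [Int.card_Ioc, sub_zero, Int.toNat_natCast] at this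
    exact_mod_cast this
  have hRb : √(∫ ω, sumOver ξ f (Finset.Ioc (0 : ℤ) n \ M) ω ^ 2 ∂P) ≤ c * √(2 * p) := by
    rw [Real.sqrt_le_left (by positivity), mul_pow, Real.sq_sqrt (by positivity)]
    refine (hc _).trans (mul_le_mul_of_nonneg_left ?_ (sq_nonneg c))
    rw [Finset.card_sdiff_of_subset hMs]
    have : (Finset.Ioc (0 : ℤ) n).card - M.card ≤ 2 * p := by
      simp only [hM, Int.card_Ioc]
      omega
    exact_mod_cast this
  have hsq : √(∫ ω, V ω ^ 2 ∂P) * √(∫ ω, V ω ^ 2 ∂P) = ∫ ω, V ω ^ 2 ∂P :=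
    Real.mul_self_sqrt (integral_sq_nonneg V)
  rcases (Real.sqrt_nonneg (∫ ω, V ω ^ 2 ∂P)).eq_or_lt with h0 | h0
  · rw [← h0]; positivity
  · refine le_of_mul_le_mul_left ?_ h0
    calc _ ≤ _ := (hsq.trans hVS).trans_le (add_le_add h1 h2)
      _ ≤ r * √(∫ ω, V ω ^ 2 ∂P) * (c * √n) + √(∫ ω, V ω ^ 2 ∂P) * (c * √(2 * p)) := by gcongr
      _ = _ := by ring

theorem tendsto_integral_condMean_sq_div (hmix : IsRhoStarMixing P ξ) :
    Tendsto (fun n : ℕ => (∫ ω, condMean P ξ f n ω ^ 2 ∂P) / n) atTop (𝓝 0) := by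
  obtain ⟨p₀, hp₀, hcov₀⟩ := hmix.exists_covLe (ε := 1 / 2) (by norm_num)
  have hK : 0 ≤ ∫ ω, f (ξ 0 ω) ^ 2 ∂P := integral_sq_nonneg _
  set c := √(3 * p₀ * ∫ ω, f (ξ 0 ω) ^ 2 ∂P)
  have hc : ∀ s : Finset ℤ, ∫ ω, sumOver ξ f s ω ^ 2 ∂P ≤ c ^ 2 * s.card := fun s => by
    rw [Real.sq_sqrt (by positivity)]
    exact integral_sumOver_sq_le hξ hstat hf hf2 hf0 hp₀ hcov₀ s
  have hc0 : 0 ≤ c := Real.sqrt_nonneg _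
  suffices h : Tendsto (fun n : ℕ => √(∫ ω, condMean P ξ f n ω ^ 2 ∂P) / √n) atTop (𝓝 0) by
    have h2 := h.pow 2
    simp only [div_pow, Real.sq_sqrt (integral_sq_nonneg _), Real.sq_sqrt (Nat.cast_nonneg _)] at h2
    simpa using h2
  rw [Metric.tendsto_atTop']
  intro ε hε
  -- The correlation times c is at most ε / 2; the added 1 avoids division by zero when c = 0.
  obtain ⟨p, -, hcov⟩ := hmix.exists_covLe (ε := ε / (2 * (c + 1))) (by positivity)
  have h1 : Tendsto (fun n : ℕ => c * √((2 * p : ℝ) / n)) atTop (𝓝 0) := by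
    have := ((Real.continuous_sqrt.tendsto _).comp
      (tendsto_const_div_atTop_nhds_zero_nat (2 * p : ℝ))).const_mul c
    simpa using this
  obtain ⟨N, hN⟩ := eventually_atTop.1 ((h1.eventually_lt_const (half_pos hε)).and
    (eventually_ge_atTop (2 * p + 1)))
  refine ⟨N, fun n hn => ?_⟩
  obtain ⟨h2, h3⟩ := hN n hn.le
  have hn0 : (0 : ℝ) < √n := Real.sqrt_pos.2 (by exact_mod_cast (by omega : 0 < n))
  have h4 := sqrt_integral_condMean_sq_le hξ hstat hf hf2 hf0 (by positivity) hcov hc0 hc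
    (show 2 * p ≤ n by omega)
  rw [dist_zero_right, Real.norm_of_nonneg (by positivity), div_lt_iff₀ hn0]
  refine h4.trans_lt ?_
  rw [Real.sqrt_div (by positivity), mul_div_assoc', div_lt_iff₀ hn0] at h2
  have h5 : ε / (2 * (c + 1)) * (c * √n) ≤ ε / 2 * √n := by
    have : ε / (2 * (c + 1)) * (c * √n) = ε / 2 * √n * (c / (c + 1)) := by field_simp
    rw [this]
    exact mul_le_of_le_one_right (by positivity) ((div_le_one (by linarith)).2 (by linarith))
  linarith

end PartialSums

/-! ### Fourth moments for bounded functions -/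

section FourthMoment

/-- What matters is that 3/2 is below 2: two halves then contribute a factor 3, below the factor 4
by which n² grows under doubling. The constant 22 is not sharp. -/
lemma add_pow_four_le (a b : ℝ) :
    (a + b) ^ 4 ≤ 3 / 2 * a ^ 4 + 3 / 2 * b ^ 4 + 22 * (a ^ 2 * b ^ 2) := by
  nlinarith [sq_nonneg (a ^ 2 + b ^ 2 - 4 * (a * b)), sq_nonneg (a ^ 2 - b ^ 2)]

lemma sum_pow_four_le {ι : Type*} (s : Finset ι) (u : ι → ℝ) :
    (∑ i ∈ s, u i) ^ 4 ≤ (s.card : ℝ) ^ 3 * ∑ i ∈ s, u i ^ 4 := by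
  have h1 : (∑ i ∈ s, u i) ^ 2 ≤ s.card * ∑ i ∈ s, u i ^ 2 := sq_sum_le_card_mul_sum_sq
  have h2 : (∑ i ∈ s, u i ^ 2) ^ 2 ≤ s.card * ∑ i ∈ s, (u i ^ 2) ^ 2 := sq_sum_le_card_mul_sum_sq
  calc (∑ i ∈ s, u i) ^ 4 = ((∑ i ∈ s, u i) ^ 2) ^ 2 := by ring
    _ ≤ (s.card * ∑ i ∈ s, u i ^ 2) ^ 2 := pow_le_pow_left₀ (sq_nonneg _) h1 2
    _ = (s.card : ℝ) ^ 2 * (∑ i ∈ s, u i ^ 2) ^ 2 := by ring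
    _ ≤ (s.card : ℝ) ^ 2 * (s.card * ∑ i ∈ s, (u i ^ 2) ^ 2) := by gcongr
    _ = _ := by simp only [← pow_mul]; ring

lemma memLp_of_abs_le {Ω : Type*} [MeasurableSpace Ω] {P : Measure Ω} [IsProbabilityMeasure P]
    {X : Ω → ℝ} (hX : Measurable X) {C : ℝ} (h : ∀ ω, |X ω| ≤ C) (q : ℝ≥0∞) :
    MemLp X q P :=
  MemLp.of_bound hX.aestronglyMeasurable C (ae_of_all _ h)

variable {Ω S : Type*} [mΩ : MeasurableSpace Ω] [mS : MeasurableSpace S] {P : Measure Ω}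
  [IsProbabilityMeasure P] {ξ : ℤ → Ω → S} {f : S → ℝ}

lemma abs_sumOver_le {Ω S : Type*} (ξ : ℤ → Ω → S) {f : S → ℝ} {M : ℝ} (hM : ∀ x, |f x| ≤ M)
    (s : Finset ℤ) (ω : Ω) : |sumOver ξ f s ω| ≤ s.card * M := by
  refine (Finset.abs_sum_le_sum_abs _ _).trans ?_
  refine (Finset.sum_le_card_nsmul _ _ M fun i _ => hM _).trans_eq ?_
  rw [nsmul_eq_mul]

variable (hξ : ∀ k, Measurable (ξ k)) (hf : Measurable f) {M : ℝ} (hM : ∀ x, |f x| ≤ M)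

include hξ hf hM

lemma memLp_sumOver_of_abs_le (s : Finset ℤ) (q : ℝ≥0∞) : MemLp (sumOver ξ f s) q P :=
  memLp_of_abs_le (measurable_sumOver hξ hf s) (abs_sumOver_le ξ hM s) q

lemma memLp_sumOver_pow_of_abs_le (s : Finset ℤ) (k : ℕ) (q : ℝ≥0∞) :
    MemLp (fun ω => sumOver ξ f s ω ^ k) q P :=
  memLp_of_abs_le ((measurable_sumOver hξ hf s).pow_const k) (C := (s.card * M) ^ k)
    (fun ω => by
      rw [abs_pow]
      exact pow_le_pow_left₀ (abs_nonneg _) (abs_sumOver_le ξ hM s ω) k) q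

/-- The mixed term E(A²B²) is estimated by the covariance inequality applied to A² and B², whose L²
norms are square roots of fourth moments. -/
lemma integral_sumOver_add_pow_four_le {p : ℕ} {r : ℝ} (hr : 0 ≤ r) (hcov : CovLe P ξ p r)
    {s t : Finset ℤ} (hst : Separated p (s : Set ℤ) t) {U V : ℝ}
    (hs4 : ∫ ω, sumOver ξ f s ω ^ 4 ∂P ≤ V) (ht4 : ∫ ω, sumOver ξ f t ω ^ 4 ∂P ≤ V)
    (hs2 : ∫ ω, sumOver ξ f s ω ^ 2 ∂P ≤ U) (ht2 : ∫ ω, sumOver ξ f t ω ^ 2 ∂P ≤ U) :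
    ∫ ω, (sumOver ξ f s ω + sumOver ξ f t ω) ^ 4 ∂P ≤ 3 * V + 22 * (U ^ 2 + r * V) := by
  set A := sumOver ξ f s
  set B := sumOver ξ f t
  have hA : ∀ k : ℕ, MemLp (fun ω => A ω ^ k) 2 P := fun k =>
    memLp_sumOver_pow_of_abs_le hξ hf hM s k 2
  have hB : ∀ k : ℕ, MemLp (fun ω => B ω ^ k) 2 P := fun k =>
    memLp_sumOver_pow_of_abs_le hξ hf hM t k 2
  have hiA : Integrable (fun ω => A ω ^ 4) P := (hA 4).integrable (by norm_num)
  have hiB : Integrable (fun ω => B ω ^ 4) P := (hB 4).integrable (by norm_num)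
  have hiAB : Integrable (fun ω => A ω ^ 2 * B ω ^ 2) P := (hA 2).integrable_mul (hB 2)
  have hU : 0 ≤ U := (integral_sq_nonneg A).trans hs2
  have hV : 0 ≤ V := (integral_nonneg fun ω => by positivity).trans hs4
  have hcov2 := hcov _ _ hst (fun ω => A ω ^ 2) (fun ω => B ω ^ 2)
    ((measurable_sumOver_sigmaGen hf subset_rfl).pow_const 2)
    ((measurable_sumOver_sigmaGen hf subset_rfl).pow_const 2) (hA 2) (hB 2)
  simp only [← pow_mul] at hcov2
  norm_num only at hcov2
  have h1 : ∫ ω, A ω ^ 2 * B ω ^ 2 ∂P ≤ U ^ 2 + r * V := by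
    have h2 : (∫ ω, A ω ^ 2 ∂P) * ∫ ω, B ω ^ 2 ∂P ≤ U * U :=
      mul_le_mul hs2 ht2 (integral_sq_nonneg B) hU
    have h3 : r * √(∫ ω, A ω ^ 4 ∂P) * √(∫ ω, B ω ^ 4 ∂P) ≤ r * √V * √V := by gcongr
    rw [mul_assoc r (√V), Real.mul_self_sqrt hV] at h3
    have := (abs_le.1 hcov2).2
    linarith
  have hmono : ∫ ω, (A ω + B ω) ^ 4 ∂P
      ≤ ∫ ω, (3 / 2 * A ω ^ 4 + 3 / 2 * B ω ^ 4 + 22 * (A ω ^ 2 * B ω ^ 2)) ∂P := by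
    refine integral_mono_of_nonneg (ae_of_all _ fun ω => by positivity)
      (((hiA.const_mul _).add (hiB.const_mul _)).add (hiAB.const_mul _))
      (ae_of_all _ fun ω => add_pow_four_le _ _)
  have hi1 : Integrable (fun ω => 3 / 2 * A ω ^ 4 + 3 / 2 * B ω ^ 4) P :=
    (hiA.const_mul _).add (hiB.const_mul _)
  rw [integral_add hi1 (hiAB.const_mul _), integral_add (hiA.const_mul _) (hiB.const_mul _),
    integral_const_mul, integral_const_mul, integral_const_mul] at hmono
  linarith

/-- Induction by halving: any two disjoint parts of a spaced set are separated. With D = 44c⁴ + M⁴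
and r ≤ 1/44, the step needs 3D + 22c⁴ + D/2 ≤ 4D, which is why c⁴ carries the coefficient 44; M⁴
covers a single point. -/
lemma integral_sumOver_pow_four_le_of_isSpaced {p : ℕ} {r : ℝ} (hr : 0 ≤ r) (hr1 : r ≤ 1 / 44)
    (hcov : CovLe P ξ p r) {c : ℝ}
    (hc : ∀ s : Finset ℤ, ∫ ω, sumOver ξ f s ω ^ 2 ∂P ≤ c ^ 2 * s.card) (j : ℕ) (s : Finset ℤ)
    (hs : IsSpaced p (s : Set ℤ)) (hj : s.card ≤ 2 ^ j) :
    ∫ ω, sumOver ξ f s ω ^ 4 ∂P ≤ (44 * c ^ 4 + M ^ 4) * 4 ^ j := by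
  induction j generalizing s with
  | zero =>
    have hb : ∀ ω, sumOver ξ f s ω ^ 4 ≤ M ^ 4 := fun ω => by
      have h0 : 0 ≤ M := (abs_nonneg _).trans (hM (ξ 0 ω))
      have h1 : (s.card : ℝ) ≤ 1 := by simpa using hj
      have h2 : |sumOver ξ f s ω| ≤ M :=
        (abs_sumOver_le ξ hM s ω).trans (mul_le_of_le_one_left h0 h1)
      calc sumOver ξ f s ω ^ 4 = |sumOver ξ f s ω| ^ 4 := by rw [Even.pow_abs (by decide)]
        _ ≤ M ^ 4 := pow_le_pow_left₀ (abs_nonneg _) h2 4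
    have h := integral_mono ((memLp_sumOver_pow_of_abs_le (P := P) hξ hf hM s 4 2).integrable
      (by norm_num)) (integrable_const (M ^ 4)) hb
    simp only [integral_const, probReal_univ, one_smul] at h
    have : 0 ≤ 44 * c ^ 4 := by positivity
    simp only [pow_zero, mul_one]
    linarith
  | succ j ih =>
    obtain ⟨t, hts, htc⟩ := Finset.exists_subset_card_eq (Nat.div_le_self s.card 2)
    have hpow : 2 ^ (j + 1) = 2 * 2 ^ j := by ring
    have htj : t.card ≤ 2 ^ j := by omega
    have hsj : (s \ t).card ≤ 2 ^ j := by
      rw [Finset.card_sdiff_of_subset hts]; omega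
    have hsep : Separated p (t : Set ℤ) ((s \ t : Finset ℤ) : Set ℤ) := fun u hu v hv => by
      rw [Finset.mem_coe, Finset.mem_sdiff] at hv
      exact hs u (hts hu) v hv.1 fun h => hv.2 (h ▸ hu)
    have h2 : ∀ u : Finset ℤ, u.card ≤ 2 ^ j →
        ∫ ω, sumOver ξ f u ω ^ 2 ∂P ≤ c ^ 2 * 2 ^ j := fun u hu =>
      (hc u).trans (mul_le_mul_of_nonneg_left (by exact_mod_cast hu) (sq_nonneg c))
    have h := integral_sumOver_add_pow_four_le hξ hf hM hr hcov hsep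
      (ih t (fun u hu v hv => hs u (hts hu) v (hts hv)) htj)
      (ih (s \ t) (fun u hu v hv => hs u (Finset.sdiff_subset hu) v (Finset.sdiff_subset hv)) hsj)
      (h2 t htj) (h2 _ hsj)
    simp only [← sumOver_add_sumOver_sdiff ξ f hts] at h
    refine h.trans ?_
    have e : (c ^ 2 * 2 ^ j) ^ 2 = c ^ 4 * (4 : ℝ) ^ j := by
      rw [mul_pow, ← pow_mul, ← pow_mul, mul_comm j, pow_mul (2 : ℝ)]; norm_num
    rw [e, pow_succ (4 : ℝ)]
    have hD : 0 ≤ (44 * c ^ 4 + M ^ 4) * (4 : ℝ) ^ j := by positivity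
    have hM4 : 0 ≤ M ^ 4 * (4 : ℝ) ^ j := by positivity
    have := mul_le_mul_of_nonneg_right hr1 hD
    linarith

lemma exists_integral_sumOver_pow_four_le {p : ℕ} (hp : 1 ≤ p) {r : ℝ} (hr : 0 ≤ r)
    (hr1 : r ≤ 1 / 44) (hcov : CovLe P ξ p r) {c : ℝ}
    (hc : ∀ s : Finset ℤ, ∫ ω, sumOver ξ f s ω ^ 2 ∂P ≤ c ^ 2 * s.card) :
    ∃ C : ℝ, 0 ≤ C ∧ ∀ s : Finset ℤ, ∫ ω, sumOver ξ f s ω ^ 4 ∂P ≤ C * (s.card : ℝ) ^ 2 := by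
  set D := 44 * c ^ 4 + M ^ 4
  have hD : 0 ≤ D := by positivity
  have hspaced : ∀ s : Finset ℤ, IsSpaced p (s : Set ℤ) →
      ∫ ω, sumOver ξ f s ω ^ 4 ∂P ≤ 4 * D * (s.card : ℝ) ^ 2 := by
    intro s hs
    rcases s.eq_empty_or_nonempty with rfl | hne
    · simp [sumOver]
    have h1 := integral_sumOver_pow_four_le_of_isSpaced hξ hf hM hr hr1 hcov hc
      (Nat.clog 2 s.card) s hs (Nat.le_pow_clog (by norm_num) _)
    refine h1.trans ?_
    have h2 : (2 : ℝ) ^ Nat.clog 2 s.card ≤ 2 * s.card := by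
      have hcard := hne.card_pos
      rcases Nat.eq_or_lt_of_le hcard with h | h
      · norm_num [show s.card = 1 from h.symm]
      · have h3 := Nat.pow_pred_clog_lt_self (b := 2) (by norm_num) (show 1 < s.card by omega)
        have h4 := Nat.clog_pos (b := 2) (by norm_num) (show 1 < s.card by omega)
        have h5 : 2 ^ Nat.clog 2 s.card = 2 * 2 ^ (Nat.clog 2 s.card).pred := by
          rw [← pow_succ', ← Nat.succ_eq_add_one, Nat.succ_pred_eq_of_pos h4]
        exact_mod_cast (by omega : 2 ^ Nat.clog 2 s.card ≤ 2 * s.card)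
    have h3 : (4 : ℝ) ^ Nat.clog 2 s.card ≤ 4 * (s.card : ℝ) ^ 2 := by
      have e : (4 : ℝ) ^ Nat.clog 2 s.card = ((2 : ℝ) ^ Nat.clog 2 s.card) ^ 2 := by
        rw [← pow_mul, mul_comm, pow_mul]; norm_num
      rw [e]
      refine (pow_le_pow_left₀ (by positivity) h2 2).trans_eq (by ring)
    calc D * 4 ^ Nat.clog 2 s.card ≤ D * (4 * (s.card : ℝ) ^ 2) := by gcongr
      _ = _ := by ring
  -- The power p⁴ is p³ from the convexity bound over residue classes times p for their number.
  refine ⟨p ^ 4 * (4 * D), by positivity, fun s => ?_⟩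
  have hpt : ∀ ω, sumOver ξ f s ω ^ 4 ≤ (p : ℝ) ^ 3 *
      ∑ a ∈ Finset.Ico (0 : ℤ) p, sumOver ξ f (s.filter fun i => i % (p : ℤ) = a) ω ^ 4 := by
    intro ω
    have h := sum_pow_four_le (Finset.Ico (0 : ℤ) p)
      (fun a => sumOver ξ f (s.filter fun i => i % (p : ℤ) = a) ω)
    simp only [sumOver] at h ⊢
    rw [Finset.sum_fiberwise_of_maps_to (emod_mem_Ico hp s)] at h
    simpa using h
  have hi : ∀ s : Finset ℤ, Integrable (fun ω => sumOver ξ f s ω ^ 4) P := fun s =>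
    (memLp_sumOver_pow_of_abs_le hξ hf hM s 4 2).integrable (by norm_num)
  have hmono := integral_mono (hi s)
    ((integrable_finsetSum (Finset.Ico (0 : ℤ) p) fun a _ =>
      hi (s.filter fun i => i % (p : ℤ) = a)).const_mul ((p : ℝ) ^ 3)) hpt
  rw [integral_const_mul, integral_finsetSum _ fun a _ => hi _] at hmono
  refine hmono.trans ?_
  have hle : ∑ a ∈ Finset.Ico (0 : ℤ) p,
      ∫ ω, sumOver ξ f (s.filter fun i => i % (p : ℤ) = a) ω ^ 4 ∂P
        ≤ ∑ a ∈ Finset.Ico (0 : ℤ) p, 4 * D * (s.card : ℝ) ^ 2 := by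
    refine Finset.sum_le_sum fun a _ => (hspaced _ (isSpaced_filter_emod p s a)).trans ?_
    gcongr
    exact Finset.filter_subset _ _
  calc _ ≤ _ := mul_le_mul_of_nonneg_left hle (by positivity)
    _ = _ := by simp; ring

end FourthMoment

/-! ### Characteristic functions under weak dependence -/

section CharFun

lemma norm_exp_mul_I_sub_le (x y : ℝ) :
    ‖Complex.exp (x * Complex.I) - Complex.exp (y * Complex.I)‖ ≤ |x - y| := by
  have e : Complex.exp (x * Complex.I) - Complex.exp (y * Complex.I)
      = Complex.exp (y * Complex.I) * (Complex.exp (Complex.I * ((x - y : ℝ) : ℂ)) - 1) := by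
    rw [mul_sub, ← Complex.exp_add]
    push_cast
    ring_nf
  rw [e, norm_mul, Complex.norm_exp_ofReal_mul_I, one_mul]
  exact Real.norm_exp_I_mul_ofReal_sub_one_le

lemma norm_exp_mul_I_sub_taylor_le (x : ℝ) :
    ‖Complex.exp (x * Complex.I) - (1 + x * Complex.I - ((x ^ 2 / 2 : ℝ) : ℂ))‖ ≤ 4 * |x| ^ 3 := by
  rcases le_total |x| 1 with h | h
  · have h1 := Complex.norm_exp_sub_sum_le_norm_mul_exp (x * Complex.I) 3
    have e : ∑ m ∈ Finset.range 3, ((x : ℂ) * Complex.I) ^ m / (m.factorial : ℂ)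
        = 1 + x * Complex.I - ((x ^ 2 / 2 : ℝ) : ℂ) := by
      simp only [Finset.sum_range_succ, Finset.sum_range_zero, mul_pow, Complex.I_sq]
      push_cast
      simp [Nat.factorial]
      ring
    rw [e] at h1
    refine h1.trans ?_
    rw [norm_mul, Complex.norm_I, mul_one, Complex.norm_real, Real.norm_eq_abs, mul_comm]
    gcongr
    calc Real.exp |x| ≤ Real.exp 1 := Real.exp_le_exp.2 h
      _ ≤ 4 := by linarith [Real.exp_one_lt_d9]
  · have h1 : ‖Complex.exp (x * Complex.I) - (1 + x * Complex.I - ((x ^ 2 / 2 : ℝ) : ℂ))‖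
        ≤ 1 + (1 + |x| + x ^ 2 / 2) := by
      refine (norm_sub_le _ _).trans ?_
      rw [Complex.norm_exp_ofReal_mul_I]
      gcongr
      refine (norm_sub_le _ _).trans ?_
      rw [Complex.norm_real, Real.norm_of_nonneg (by positivity)]
      gcongr
      refine (norm_add_le _ _).trans ?_
      simp
    refine h1.trans ?_
    rw [← sq_abs x]
    have h2 : 1 ≤ |x| ^ 2 := one_le_pow₀ h
    have h3 : |x| ^ 2 ≤ |x| ^ 3 := pow_le_pow_right₀ h (by norm_num)
    nlinarith

lemma norm_pow_sub_pow_le_mul {a b : ℂ} (ha : ‖a‖ ≤ 1) (hb : ‖b‖ ≤ 1) (k : ℕ) :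
    ‖a ^ k - b ^ k‖ ≤ k * ‖a - b‖ := by
  induction k with
  | zero => simp
  | succ k ih =>
    have e : a ^ (k + 1) - b ^ (k + 1) = a ^ k * (a - b) + (a ^ k - b ^ k) * b := by ring
    rw [e]
    refine (norm_add_le _ _).trans ?_
    rw [norm_mul, norm_mul, norm_pow]
    have h1 : ‖a‖ ^ k * ‖a - b‖ ≤ ‖a - b‖ :=
      mul_le_of_le_one_left (norm_nonneg _) (pow_le_one₀ (norm_nonneg _) ha)
    have h2 : ‖a ^ k - b ^ k‖ * ‖b‖ ≤ ‖a ^ k - b ^ k‖ :=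
      mul_le_of_le_one_right (norm_nonneg _) hb
    push_cast
    linarith

variable {Ω S : Type*} [mΩ : MeasurableSpace Ω] [mS : MeasurableSpace S]

/-- The expectation of `exp (i X)`. -/
noncomputable def charE (P : Measure Ω) (X : Ω → ℝ) : ℂ :=
  ∫ ω, Complex.exp (X ω * Complex.I) ∂P

variable {P : Measure Ω}

lemma charE_eq_of_identDistrib {X Y : Ω → ℝ} (h : IdentDistrib X Y P P) :
    charE P X = charE P Y :=
  (h.comp (u := fun x : ℝ => Complex.exp (x * Complex.I)) (by fun_prop)).integral_eq

variable [IsProbabilityMeasure P]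

lemma integrable_exp_mul_I {X : Ω → ℝ} (hX : Measurable X) :
    Integrable (fun ω => Complex.exp (X ω * Complex.I)) P :=
  Integrable.of_bound (by fun_prop) 1
    (ae_of_all _ fun ω => (Complex.norm_exp_ofReal_mul_I _).le)

lemma norm_charE_le_one (X : Ω → ℝ) : ‖charE P X‖ ≤ 1 := by
  have h := norm_integral_le_of_norm_le_const (μ := P)
    (ae_of_all _ fun ω => (Complex.norm_exp_ofReal_mul_I (X ω)).le)
  simpa [charE] using h

lemma charE_eq_cos_add_sin {X : Ω → ℝ} (hX : Measurable X) :
    charE P X = ((∫ ω, Real.cos (X ω) ∂P : ℝ) : ℂ)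
      + ((∫ ω, Real.sin (X ω) ∂P : ℝ) : ℂ) * Complex.I := by
  have hc : Integrable (fun ω => ((Real.cos (X ω) : ℝ) : ℂ)) P :=
    ((memLp_of_abs_le (Real.measurable_cos.comp hX)
      (fun ω => Real.abs_cos_le_one (X ω)) 1).integrable le_rfl).ofReal
  have hs : Integrable (fun ω => ((Real.sin (X ω) : ℝ) : ℂ)) P :=
    ((memLp_of_abs_le (Real.measurable_sin.comp hX)
      (fun ω => Real.abs_sin_le_one (X ω)) 1).integrable le_rfl).ofReal
  rw [← integral_complex_ofReal, ← integral_complex_ofReal, ← integral_mul_const,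
    ← integral_add hc (hs.mul_const _), charE]
  refine integral_congr_ae (ae_of_all _ fun ω => ?_)
  simp [Complex.exp_mul_I]

lemma norm_charE_sub_le {X Y : Ω → ℝ} (hX : Measurable X) (hY : Measurable Y)
    (h : MemLp (fun ω => X ω - Y ω) 2 P) :
    ‖charE P X - charE P Y‖ ≤ √(∫ ω, (X ω - Y ω) ^ 2 ∂P) := by
  rw [charE, charE, ← integral_sub (integrable_exp_mul_I hX) (integrable_exp_mul_I hY)]
  refine (norm_integral_le_of_norm_le (h.integrable (by norm_num)).abs
    (ae_of_all _ fun ω => norm_exp_mul_I_sub_le _ _)).trans ?_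
  exact integral_abs_le_sqrt_integral_sq h

/-- The Taylor remainder is a third absolute moment, which Cauchy–Schwarz applied to |X| · X² bounds
by second and fourth moments. -/
lemma norm_charE_sub_taylor_le {X : Ω → ℝ} (hX : Measurable X) (h4 : MemLp X 4 P)
    (h0 : ∫ ω, X ω ∂P = 0) :
    ‖charE P X - ((1 - (∫ ω, X ω ^ 2 ∂P) / 2 : ℝ) : ℂ)‖
      ≤ 4 * (√(∫ ω, X ω ^ 2 ∂P) * √(∫ ω, X ω ^ 4 ∂P)) := by
  have h2 : MemLp X 2 P := h4.mono_exponent (by norm_num)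
  have h22 : MemLp (fun ω => X ω ^ 2) 2 P := by
    rw [memLp_two_iff_integrable_sq (by fun_prop)]
    have := h4.integrable_norm_pow' (p := 4)
    simpa [← pow_mul, Even.pow_abs (show Even 4 by decide)] using this
  have hi1 : Integrable (fun ω => ((X ω : ℝ) : ℂ)) P := (h2.integrable (by norm_num)).ofReal
  have hi2 : Integrable (fun ω => ((X ω ^ 2 / 2 : ℝ) : ℂ)) P := (h2.integrable_sq.div_const 2).ofReal
  have hi12 : Integrable (fun ω => 1 + ((X ω : ℝ) : ℂ) * Complex.I) P :=
    (integrable_const _).add (hi1.mul_const _)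
  have e : ((1 - (∫ ω, X ω ^ 2 ∂P) / 2 : ℝ) : ℂ)
      = ∫ ω, (1 + X ω * Complex.I - ((X ω ^ 2 / 2 : ℝ) : ℂ)) ∂P := by
    rw [integral_sub hi12 hi2, integral_add (integrable_const _) (hi1.mul_const _),
      integral_mul_const, integral_complex_ofReal, integral_complex_ofReal, h0, integral_div]
    simp
  have hprod : Integrable (fun ω => |X ω| * X ω ^ 2) P := h2.norm.integrable_mul h22
  have hcube : ∀ ω, |X ω| * X ω ^ 2 = |X ω| ^ 3 := fun ω => by rw [← sq_abs]; ring
  simp only [hcube] at hprod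
  have hi3 : Integrable (fun ω => 1 + X ω * Complex.I - ((X ω ^ 2 / 2 : ℝ) : ℂ)) P := hi12.sub hi2
  rw [e, charE, ← integral_sub (integrable_exp_mul_I hX) hi3]
  refine (norm_integral_le_of_norm_le (hprod.const_mul 4)
    (ae_of_all _ fun ω => norm_exp_mul_I_sub_taylor_le (X ω))).trans ?_
  rw [integral_const_mul]
  gcongr
  have h := abs_integral_mul_le_sqrt h2.norm h22
  simp only [Real.norm_eq_abs, hcube, sq_abs, ← pow_mul] at h
  exact (le_abs_self _).trans h

variable {ξ : ℤ → Ω → S} {p : ℕ} {r : ℝ}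

lemma CovLe.abs_integral_mul_sub_le (hcov : CovLe P ξ p r) (hr : 0 ≤ r) {I J : Set ℤ}
    (hIJ : Separated p I J) {X Y : Ω → ℝ} (hX : Measurable[sigmaGen ξ I] X)
    (hY : Measurable[sigmaGen ξ J] Y) (hX0 : Measurable X) (hY0 : Measurable Y)
    (hX1 : ∀ ω, |X ω| ≤ 1) (hY1 : ∀ ω, |Y ω| ≤ 1) :
    |∫ ω, X ω * Y ω ∂P - (∫ ω, X ω ∂P) * ∫ ω, Y ω ∂P| ≤ r := by
  have hb : ∀ Z : Ω → ℝ, Measurable Z → (∀ ω, |Z ω| ≤ 1) → √(∫ ω, Z ω ^ 2 ∂P) ≤ 1 := by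
    intro Z hZ hZ1
    rw [Real.sqrt_le_left zero_le_one, one_pow]
    have h := integral_mono (memLp_of_abs_le hZ hZ1 2 : MemLp Z 2 P).integrable_sq
      (integrable_const 1) (fun ω => by
        rw [← sq_abs]; exact pow_le_one₀ (abs_nonneg _) (hZ1 ω))
    simpa using h
  refine (hcov I J hIJ X Y hX hY (memLp_of_abs_le hX0 hX1 2) (memLp_of_abs_le hY0 hY1 2)).trans ?_
  calc _ ≤ r * 1 * 1 := by
        gcongr
        · exact hb X hX0 hX1
        · exact hb Y hY0 hY1
    _ = r := by ring

/-- The covariance inequality is for real functions, so the exponentials are split into cosines and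
sines; each of the resulting four covariances costs at most r. -/
lemma CovLe.norm_charE_add_sub_le (hcov : CovLe P ξ p r) (hr : 0 ≤ r) {I J : Set ℤ}
    (hIJ : Separated p I J) {X Y : Ω → ℝ} (hX : Measurable[sigmaGen ξ I] X)
    (hY : Measurable[sigmaGen ξ J] Y) (hX0 : Measurable X) (hY0 : Measurable Y) :
    ‖charE P (fun ω => X ω + Y ω) - charE P X * charE P Y‖ ≤ 4 * r := by
  have cX : Measurable fun ω => Real.cos (X ω) := Real.measurable_cos.comp hX0
  have cY : Measurable fun ω => Real.cos (Y ω) := Real.measurable_cos.comp hY0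
  have sX : Measurable fun ω => Real.sin (X ω) := Real.measurable_sin.comp hX0
  have sY : Measurable fun ω => Real.sin (Y ω) := Real.measurable_sin.comp hY0
  have bcX : ∀ ω, |Real.cos (X ω)| ≤ 1 := fun ω => Real.abs_cos_le_one _
  have bcY : ∀ ω, |Real.cos (Y ω)| ≤ 1 := fun ω => Real.abs_cos_le_one _
  have bsX : ∀ ω, |Real.sin (X ω)| ≤ 1 := fun ω => Real.abs_sin_le_one _
  have bsY : ∀ ω, |Real.sin (Y ω)| ≤ 1 := fun ω => Real.abs_sin_le_one _
  have hcc := hcov.abs_integral_mul_sub_le hr hIJ (Real.measurable_cos.comp hX)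
    (Real.measurable_cos.comp hY) cX cY bcX bcY
  have hss := hcov.abs_integral_mul_sub_le hr hIJ (Real.measurable_sin.comp hX)
    (Real.measurable_sin.comp hY) sX sY bsX bsY
  have hsc := hcov.abs_integral_mul_sub_le hr hIJ (Real.measurable_sin.comp hX)
    (Real.measurable_cos.comp hY) sX cY bsX bcY
  have hcs := hcov.abs_integral_mul_sub_le hr hIJ (Real.measurable_cos.comp hX)
    (Real.measurable_sin.comp hY) cX sY bcX bsY
  have imul : ∀ {U V : Ω → ℝ}, Measurable U → Measurable V → (∀ ω, |U ω| ≤ 1) →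
      (∀ ω, |V ω| ≤ 1) → Integrable (fun ω => U ω * V ω) P := fun hU hV bU bV =>
    (memLp_of_abs_le hU bU 2).integrable_mul (memLp_of_abs_le hV bV 2)
  have hcos : ∫ ω, Real.cos (X ω + Y ω) ∂P
      = ∫ ω, Real.cos (X ω) * Real.cos (Y ω) ∂P - ∫ ω, Real.sin (X ω) * Real.sin (Y ω) ∂P := by
    rw [← integral_sub (imul cX cY bcX bcY) (imul sX sY bsX bsY)]
    simp_rw [Real.cos_add]
  have hsin : ∫ ω, Real.sin (X ω + Y ω) ∂P
      = ∫ ω, Real.sin (X ω) * Real.cos (Y ω) ∂P + ∫ ω, Real.cos (X ω) * Real.sin (Y ω) ∂P := by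
    rw [← integral_add (imul sX cY bsX bcY) (imul cX sY bcX bsY)]
    simp_rw [Real.sin_add]
  refine (Complex.norm_le_abs_re_add_abs_im _).trans ?_
  have hXY : Measurable (fun ω => X ω + Y ω) := hX0.add hY0
  rw [charE_eq_cos_add_sin hXY, charE_eq_cos_add_sin hX0, charE_eq_cos_add_sin hY0]
  simp only [Complex.sub_re, Complex.add_re, Complex.mul_re, Complex.add_im,
    Complex.mul_im, Complex.sub_im, Complex.ofReal_re, Complex.ofReal_im, Complex.I_re,
    Complex.I_im, mul_zero, mul_one, sub_zero, add_zero, zero_add]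
  rw [hcos, hsin]
  simp only [Function.comp_apply] at hcc hss hsc hcs
  rw [abs_le] at hcc hss hsc hcs
  have h1 : ∀ a : ℝ, ∀ b, a ≤ b → -b ≤ a → |a| ≤ b := fun a b h h' => abs_le.2 ⟨h', h⟩
  have hre := h1 (∫ ω, Real.cos (X ω) * Real.cos (Y ω) ∂P - ∫ ω, Real.sin (X ω) * Real.sin (Y ω) ∂P
    - ((∫ ω, Real.cos (X ω) ∂P) * (∫ ω, Real.cos (Y ω) ∂P)
      - (∫ ω, Real.sin (X ω) ∂P) * ∫ ω, Real.sin (Y ω) ∂P)) (2 * r) (by linarith) (by linarith)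
  have him := h1 (∫ ω, Real.sin (X ω) * Real.cos (Y ω) ∂P + ∫ ω, Real.cos (X ω) * Real.sin (Y ω) ∂P
    - ((∫ ω, Real.cos (X ω) ∂P) * (∫ ω, Real.sin (Y ω) ∂P)
      + (∫ ω, Real.sin (X ω) ∂P) * ∫ ω, Real.cos (Y ω) ∂P)) (2 * r) (by linarith) (by linarith)
  linarith

/-- Blocks are peeled off one at a time at cost 4r; earlier errors do not grow because
characteristic functions are bounded by 1. -/
lemma CovLe.norm_charE_sum_sub_prod_le (hcov : CovLe P ξ p r) (hr : 0 ≤ r) (hp : 1 ≤ p)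
    (hξ : ∀ k, Measurable (ξ k)) {f : S → ℝ} (hf : Measurable f) (τ : ℝ) (b : ℕ → Finset ℤ)
    (hb : ∀ i j, i ≠ j → Separated p (b i : Set ℤ) (b j)) (k : ℕ) :
    ‖charE P (fun ω => τ * ∑ j ∈ Finset.range k, sumOver ξ f (b j) ω)
      - ∏ j ∈ Finset.range k, charE P (fun ω => τ * sumOver ξ f (b j) ω)‖ ≤ 4 * r * k := by
  induction k with
  | zero => simp [charE]
  | succ k ih =>
    have hd : ((Finset.range k : Finset ℕ) : Set ℕ).PairwiseDisjoint b := fun i _ j _ hij => by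
      rw [Function.onFun, ← Finset.disjoint_coe]
      exact (hb i j hij).disjoint hp
    have hU : (fun ω => ∑ j ∈ Finset.range k, sumOver ξ f (b j) ω)
        = sumOver ξ f ((Finset.range k).biUnion b) := by
      ext ω
      simp only [sumOver]
      rw [Finset.sum_biUnion hd]
    have hsep : Separated p (((Finset.range k).biUnion b : Finset ℤ) : Set ℤ) (b k) := by
      have := Separated.biUnion (p := p) (b := b) (s := Finset.range k) (t := {k})
        (fun i hi j hj => by
          rw [Finset.mem_singleton] at hj
          rw [Finset.mem_range] at hi
          exact hb i j (by omega))
      simpa using this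
    have h1 := hcov.norm_charE_add_sub_le hr hsep
      (X := fun ω => τ * sumOver ξ f ((Finset.range k).biUnion b) ω)
      (Y := fun ω => τ * sumOver ξ f (b k) ω)
      ((measurable_sumOver_sigmaGen hf subset_rfl).const_mul τ)
      ((measurable_sumOver_sigmaGen hf subset_rfl).const_mul τ)
      ((measurable_sumOver hξ hf _).const_mul τ) ((measurable_sumOver hξ hf _).const_mul τ)
    rw [← hU] at h1
    simp only [← mul_add, ← Finset.sum_range_succ] at h1
    rw [Finset.prod_range_succ]
    set a := charE P (fun ω => τ * ∑ j ∈ Finset.range k, sumOver ξ f (b j) ω)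
    set c := charE P (fun ω => τ * sumOver ξ f (b k) ω)
    set q := ∏ j ∈ Finset.range k, charE P (fun ω => τ * sumOver ξ f (b j) ω)
    have h2 : ‖(a - q) * c‖ ≤ ‖a - q‖ := by
      rw [norm_mul]
      exact mul_le_of_le_one_right (norm_nonneg _) (norm_charE_le_one _)
    have e : charE P (fun ω => τ * ∑ j ∈ Finset.range (k + 1), sumOver ξ f (b j) ω) - q * c
        = (charE P (fun ω => τ * ∑ j ∈ Finset.range (k + 1), sumOver ξ f (b j) ω) - a * c)
          + (a - q) * c := by ring
    rw [e]
    refine (norm_add_le _ _).trans ?_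
    push_cast
    linarith

end CharFun

/-! ### Central limit theorem for bounded functions -/

section Bounded

lemma tendsto_div_sub_div_natCast {k : ℕ} (hk : 1 ≤ k) (p : ℕ) :
    Tendsto (fun n : ℕ => ((n / k - p : ℕ) : ℝ) / n) atTop (𝓝 (1 / k)) := by
  have hk' : (0 : ℝ) < k := by exact_mod_cast hk
  rw [tendsto_iff_norm_sub_tendsto_zero]
  refine squeeze_zero' (Eventually.of_forall fun n => norm_nonneg _) ?_
    (tendsto_const_div_atTop_nhds_zero_nat ((p : ℝ) + 1))
  filter_upwards [eventually_ge_atTop (k * p + 1)] with n hn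
  have hn' : (0 : ℝ) < n := by exact_mod_cast (by omega : 0 < n)
  have hpk : p ≤ n / k := (Nat.le_div_iff_mul_le (by omega)).2 (by rw [mul_comm]; omega)
  have h1 : ((k * (n / k) : ℕ) : ℝ) ≤ n := by exact_mod_cast Nat.mul_div_le n k
  have h2 : (n : ℝ) ≤ ((k * (n / k) + k : ℕ) : ℝ) := by
    exact_mod_cast (Nat.lt_mul_div_succ n (by omega : 0 < k)).le.trans_eq (by ring)
  push_cast [Nat.cast_sub hpk] at h1 h2 ⊢
  set q : ℝ := ((n / k : ℕ) : ℝ)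
  rw [Real.norm_eq_abs, abs_le, ← neg_div, le_sub_iff_add_le, sub_le_iff_le_add]
  constructor
  · rw [div_add_div _ _ hn'.ne' hk'.ne', div_le_div_iff₀ (by positivity) hn']
    have : (-((p : ℝ) + 1) * k + n) ≤ (q - p) * k := by nlinarith
    nlinarith
  · rw [div_add_div _ _ hn'.ne' hk'.ne', div_le_div_iff₀ hn' (by positivity)]
    have : (q - p) * k ≤ ((p : ℝ) + 1) * k + n := by
      nlinarith [mul_nonneg (Nat.cast_nonneg (α := ℝ) p) hk'.le]
    nlinarith

lemma norm_one_sub_sub_exp_neg_le {x : ℝ} (hx0 : 0 ≤ x) (hx1 : x ≤ 1) :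
    |1 - x - Real.exp (-x)| ≤ x ^ 2 := by
  have h := Real.abs_exp_sub_one_sub_id_le (x := -x) (by rw [abs_neg, abs_of_nonneg hx0]; exact hx1)
  rw [abs_sub_comm]
  rw [neg_sq] at h
  convert h using 2
  ring

variable {Ω S : Type*} [mΩ : MeasurableSpace Ω] [mS : MeasurableSpace S] {P : Measure Ω}
  [IsProbabilityMeasure P] {ξ : ℤ → Ω → S} {f : S → ℝ}
  (hξ : ∀ k, Measurable (ξ k)) (hf : Measurable f)

include hξ hf

/-- The three errors are the Taylor remainder, of order k^(-3/2) by the moment bounds, the deviation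
of the block variance from v²/k, and the replacement of 1 - x by exp(-x). -/
lemma norm_charE_block_sub_le {M : ℝ} (hM : ∀ x, |f x| ≤ M)
    (hf0 : ∀ s, ∫ ω, sumOver ξ f s ω ∂P = 0) {c C : ℝ} (hC0 : 0 ≤ C)
    (hc : ∀ s : Finset ℤ, ∫ ω, sumOver ξ f s ω ^ 2 ∂P ≤ c ^ 2 * s.card)
    (hC : ∀ s : Finset ℤ, ∫ ω, sumOver ξ f s ω ^ 4 ∂P ≤ C * (s.card : ℝ) ^ 2)
    {t v : ℝ} {k n l : ℕ} (hk : 1 ≤ k) (hn : 1 ≤ n) (hkl : k * l ≤ n)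
    (hx : t ^ 2 * v ^ 2 / (2 * k) ≤ 1) :
    ‖charE P (fun ω => t / √n * sumOver ξ f (Finset.Ioc (0 : ℤ) l) ω)
        - (Real.exp (-(t ^ 2 * v ^ 2 / (2 * k))) : ℂ)‖
      ≤ 4 * (√(c ^ 2 * (t ^ 2 / k)) * (√C * (t ^ 2 / k)))
        + t ^ 2 / 2 * |(∫ ω, sumOver ξ f (Finset.Ioc (0 : ℤ) l) ω ^ 2 ∂P) / n - v ^ 2 / k|
        + (t ^ 2 * v ^ 2 / (2 * k)) ^ 2 := by
  have hn' : (0 : ℝ) < n := by exact_mod_cast hn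
  have hk' : (0 : ℝ) < k := by exact_mod_cast hk
  set Y := sumOver ξ f (Finset.Ioc (0 : ℤ) l)
  set X : Ω → ℝ := fun ω => t / √n * Y ω with hX
  have hYm : Measurable Y := measurable_sumOver hξ hf _
  have hX4 : MemLp X 4 P := (memLp_sumOver_of_abs_le hξ hf hM _ 4).const_mul _
  have hX0 : ∫ ω, X ω ∂P = 0 := by
    rw [hX, integral_const_mul, hf0, mul_zero]
  have hτ2 : (t / √n) ^ 2 = t ^ 2 / n := by rw [div_pow, Real.sq_sqrt hn'.le]
  have hτ4 : (t / √n) ^ 4 = (t ^ 2 / n) ^ 2 := by rw [← hτ2, ← pow_mul]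
  have hX2i : ∫ ω, X ω ^ 2 ∂P = t ^ 2 / n * ∫ ω, Y ω ^ 2 ∂P := by
    simp only [hX, mul_pow, hτ2]
    rw [integral_const_mul]
  have hX4i : ∫ ω, X ω ^ 4 ∂P = (t ^ 2 / n) ^ 2 * ∫ ω, Y ω ^ 4 ∂P := by
    simp only [hX, mul_pow, hτ4]
    rw [integral_const_mul]
  have hu : t ^ 2 / n * l ≤ t ^ 2 / k := by
    rw [div_mul_eq_mul_div, div_le_div_iff₀ hn' hk', mul_assoc]
    refine mul_le_mul_of_nonneg_left ?_ (sq_nonneg t)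
    rw [mul_comm]
    exact_mod_cast hkl
  have hcard : ((Finset.Ioc (0 : ℤ) l).card : ℝ) = l := by simp
  have hX2b : ∫ ω, X ω ^ 2 ∂P ≤ c ^ 2 * (t ^ 2 / k) := by
    have h := hc (Finset.Ioc (0 : ℤ) l)
    rw [hcard] at h
    calc ∫ ω, X ω ^ 2 ∂P ≤ t ^ 2 / n * (c ^ 2 * l) := by rw [hX2i]; gcongr
      _ = c ^ 2 * (t ^ 2 / n * l) := by ring
      _ ≤ _ := by gcongr
  have hX4b : ∫ ω, X ω ^ 4 ∂P ≤ C * (t ^ 2 / k) ^ 2 := by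
    have h := hC (Finset.Ioc (0 : ℤ) l)
    rw [hcard] at h
    calc ∫ ω, X ω ^ 4 ∂P ≤ (t ^ 2 / n) ^ 2 * (C * l ^ 2) := by rw [hX4i]; gcongr
      _ = C * (t ^ 2 / n * l) ^ 2 := by ring
      _ ≤ _ := by gcongr
  have h1 := norm_charE_sub_taylor_le (hYm.const_mul (t / √n)) hX4 hX0
  have h2 : √(∫ ω, X ω ^ 2 ∂P) * √(∫ ω, X ω ^ 4 ∂P)
      ≤ √(c ^ 2 * (t ^ 2 / k)) * (√C * (t ^ 2 / k)) := by
    have h3 : √(C * (t ^ 2 / k) ^ 2) = √C * (t ^ 2 / k) := by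
      rw [Real.sqrt_mul hC0, Real.sqrt_sq (by positivity)]
    rw [← h3]
    gcongr
  set x := t ^ 2 * v ^ 2 / (2 * k)
  have h4 : |1 - (∫ ω, X ω ^ 2 ∂P) / 2 - (1 - x)|
      ≤ t ^ 2 / 2 * |(∫ ω, Y ω ^ 2 ∂P) / n - v ^ 2 / k| := by
    have e : 1 - (∫ ω, X ω ^ 2 ∂P) / 2 - (1 - x)
        = -(t ^ 2 / 2 * ((∫ ω, Y ω ^ 2 ∂P) / n - v ^ 2 / k)) := by
      rw [hX2i]; simp only [x]; field_simp; ring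
    rw [e, abs_neg, abs_mul, abs_of_nonneg (by positivity : 0 ≤ t ^ 2 / 2)]
  have h5 := norm_one_sub_sub_exp_neg_le (by positivity : 0 ≤ x) hx
  have e : charE P X - (Real.exp (-x) : ℂ)
      = (charE P X - ((1 - (∫ ω, X ω ^ 2 ∂P) / 2 : ℝ) : ℂ))
        + (((1 - (∫ ω, X ω ^ 2 ∂P) / 2 - (1 - x) : ℝ)) : ℂ)
        + ((1 - x - Real.exp (-x) : ℝ) : ℂ) := by push_cast; ring
  rw [e]
  refine (norm_add₃_le).trans ?_
  rw [Complex.norm_real, Complex.norm_real, Real.norm_eq_abs, Real.norm_eq_abs]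
  have h6 := h1.trans (mul_le_mul_of_nonneg_left h2 (by norm_num : (0 : ℝ) ≤ 4))
  linarith

/-- The errors are, in order, for dropping the gaps, for factoring over the k blocks, and k times
the error of one block. -/
lemma norm_charE_sum_sub_exp_le (hstat : IsStationary P ξ) {M : ℝ} (hM : ∀ x, |f x| ≤ M)
    (hf0 : ∀ s, ∫ ω, sumOver ξ f s ω ∂P = 0) {c C : ℝ} (hC0 : 0 ≤ C)
    (hc : ∀ s : Finset ℤ, ∫ ω, sumOver ξ f s ω ^ 2 ∂P ≤ c ^ 2 * s.card)
    (hC : ∀ s : Finset ℤ, ∫ ω, sumOver ξ f s ω ^ 4 ∂P ≤ C * (s.card : ℝ) ^ 2)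
    {p : ℕ} {r : ℝ} (hp : 1 ≤ p) (hr : 0 ≤ r) (hcov : CovLe P ξ p r)
    {t v : ℝ} {k n : ℕ} (hk : 1 ≤ k) (hn : k * p ≤ n)
    (hx : t ^ 2 * v ^ 2 / (2 * k) ≤ 1) :
    ‖charE P (fun ω => t / √n * sumOver ξ f (Finset.Ioc (0 : ℤ) n) ω)
        - (Real.exp (-(t ^ 2 * v ^ 2 / 2)) : ℂ)‖
      ≤ √(t ^ 2 * (c ^ 2 * (k * p + k)) / n) + 4 * r * k
        + k * (4 * (√(c ^ 2 * (t ^ 2 / k)) * (√C * (t ^ 2 / k)))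
          + t ^ 2 / 2
            * |(∫ ω, sumOver ξ f (Finset.Ioc (0 : ℤ) (n / k - p : ℕ)) ω ^ 2 ∂P) / n - v ^ 2 / k|
          + (t ^ 2 * v ^ 2 / (2 * k)) ^ 2) := by
  have hpL : p ≤ n / k := (Nat.le_div_iff_mul_le (by omega)).2 (by rwa [mul_comm])
  have hn1 : 1 ≤ n := (Nat.mul_pos hk hp).trans_le hn
  have hn' : (0 : ℝ) < n := by exact_mod_cast hn1
  have hk' : (0 : ℝ) < k := by exact_mod_cast hk
  set L := n / k with hL
  set l := L - p with hl
  have hlL : l < L := by omega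
  have hkL : k * L ≤ n := Nat.mul_div_le n k
  have hkl : k * l ≤ n := (Nat.mul_le_mul_left k hlL.le).trans hkL
  have hS : ∀ ω, sumOver ξ f (Finset.Ioc (0 : ℤ) n) ω
      = ∑ j ∈ Finset.range k, sumOver ξ f (block L l j) ω + sumOver ξ f (blockGap L l k n) ω :=
    fun ω => sum_eq_sum_block_add (fun i => f (ξ i ω)) hlL hkL
  set τ := t / √n with hτ
  have hτ2 : τ ^ 2 = t ^ 2 / n := by rw [hτ, div_pow, Real.sq_sqrt hn'.le]
  have hSm : ∀ s, Measurable (fun ω => τ * sumOver ξ f s ω) := fun s =>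
    (measurable_sumOver hξ hf s).const_mul τ
  have hBm : Measurable (fun ω => τ * ∑ j ∈ Finset.range k, sumOver ξ f (block L l j) ω) :=
    (Finset.measurable_fun_sum _ fun j _ => measurable_sumOver hξ hf _).const_mul τ
  have e : ∀ ω, τ * sumOver ξ f (Finset.Ioc (0 : ℤ) n) ω
      - τ * ∑ j ∈ Finset.range k, sumOver ξ f (block L l j) ω
      = τ * sumOver ξ f (blockGap L l k n) ω := fun ω => by rw [hS]; ring
  have h1 : ‖charE P (fun ω => τ * sumOver ξ f (Finset.Ioc (0 : ℤ) n) ω)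
      - charE P (fun ω => τ * ∑ j ∈ Finset.range k, sumOver ξ f (block L l j) ω)‖
      ≤ √(t ^ 2 * (c ^ 2 * (k * p + k)) / n) := by
    have h := norm_charE_sub_le (P := P) (hSm (Finset.Ioc (0 : ℤ) n)) hBm (by
      simp only [e]
      exact (memLp_sumOver_of_abs_le hξ hf hM _ 2).const_mul _)
    refine h.trans (Real.sqrt_le_sqrt ?_)
    simp only [e, mul_pow]
    rw [integral_const_mul, hτ2, mul_div_right_comm]
    refine mul_le_mul_of_nonneg_left ((hc _).trans ?_) (by positivity)
    refine mul_le_mul_of_nonneg_left ?_ (sq_nonneg c)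
    rw [card_blockGap hlL hkL]
    have h3 : n < k * (L + 1) := Nat.lt_mul_div_succ n (by omega)
    have h4 : L = l + p := by omega
    -- The gaps account for k p points and the remainder of n modulo k for fewer than k.
    have h5 : n - k * l ≤ k * p + k := by
      rw [h4] at h3
      have : k * (l + p + 1) = k * l + k * p + k := by ring
      omega
    exact_mod_cast h5
  have h2 := hcov.norm_charE_sum_sub_prod_le hr hp hξ hf τ (block L l)
    (fun i j hij => (separated_block hlL.le hij).of_le (by omega)) k
  have hφ : ∀ j, charE P (fun ω => τ * sumOver ξ f (block L l j) ω)
      = charE P (fun ω => τ * sumOver ξ f (Finset.Ioc (0 : ℤ) l) ω) := fun j =>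
    charE_eq_of_identDistrib
      ((hstat.identDistrib_block hξ hf L l j).comp (measurable_const_mul τ))
  simp only [hφ, Finset.prod_const, Finset.card_range] at h2
  have h3 := norm_charE_block_sub_le hξ hf hM hf0 hC0 hc hC (t := t) (v := v) hk hn1 hkl hx
  set φ := charE P (fun ω => τ * sumOver ξ f (Finset.Ioc (0 : ℤ) l) ω)
  set x := t ^ 2 * v ^ 2 / (2 * k) with hxdef
  have hx0 : 0 ≤ x := by positivity
  have h4 : (Real.exp (-(t ^ 2 * v ^ 2 / 2)) : ℂ) = (Real.exp (-x) : ℂ) ^ k := by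
    rw [← Complex.ofReal_pow, ← Real.exp_nat_mul, hxdef]
    congr 2
    field_simp
  have h5 : ‖(Real.exp (-x) : ℂ)‖ ≤ 1 := by
    rw [Complex.norm_real, Real.norm_of_nonneg (Real.exp_nonneg _), Real.exp_le_one_iff]
    linarith
  have h6 := norm_pow_sub_pow_le_mul (norm_charE_le_one (P := P) _ : ‖φ‖ ≤ 1) h5 k
  rw [h4]
  set a := charE P (fun ω => τ * sumOver ξ f (Finset.Ioc (0 : ℤ) n) ω)
  set b := charE P (fun ω => τ * ∑ j ∈ Finset.range k, sumOver ξ f (block L l j) ω)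
  have e2 : a - (Real.exp (-x) : ℂ) ^ k = (a - b) + (b - φ ^ k)
      + (φ ^ k - (Real.exp (-x) : ℂ) ^ k) := by ring
  rw [e2]
  refine norm_add₃_le.trans ?_
  have h7 := h6.trans (mul_le_mul_of_nonneg_left h3 hk'.le)
  linarith

theorem tendsto_charE_of_abs_le (hstat : IsStationary P ξ) (hmix : IsRhoStarMixing P ξ)
    {M : ℝ} (hM : ∀ x, |f x| ≤ M) (hf0 : ∫ ω, f (ξ 0 ω) ∂P = 0) {v : ℝ}
    (hv : Tendsto (fun n : ℕ => √(∫ ω, sumOver ξ f (Finset.Ioc (0 : ℤ) n) ω ^ 2 ∂P) / √n)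
      atTop (𝓝 v)) (t : ℝ) :
    Tendsto (fun n : ℕ => charE P (fun ω => t / √n * sumOver ξ f (Finset.Ioc (0 : ℤ) n) ω)) atTop
      (𝓝 (Real.exp (-(t ^ 2 * v ^ 2 / 2)) : ℂ)) := by
  have hf2 : MemLp (fun ω => f (ξ 0 ω)) 2 P :=
    memLp_of_abs_le (hf.comp (hξ 0)) (fun ω => hM _) 2
  have hf0' := integral_sumOver_eq_zero hξ hstat hf hf2 hf0
  obtain ⟨c, hc⟩ : ∃ c : ℝ, ∀ s : Finset ℤ, ∫ ω, sumOver ξ f s ω ^ 2 ∂P ≤ c ^ 2 * s.card := by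
    obtain ⟨p, hp, hcov⟩ := hmix.exists_covLe (ε := 1 / 2) (by norm_num)
    refine ⟨√(3 * p * ∫ ω, f (ξ 0 ω) ^ 2 ∂P), fun s => ?_⟩
    rw [Real.sq_sqrt (mul_nonneg (by positivity) (integral_sq_nonneg _))]
    exact integral_sumOver_sq_le hξ hstat hf hf2 hf0 hp hcov s
  obtain ⟨C, hC0, hC⟩ : ∃ C : ℝ, 0 ≤ C ∧
      ∀ s : Finset ℤ, ∫ ω, sumOver ξ f s ω ^ 4 ∂P ≤ C * (s.card : ℝ) ^ 2 := by
    obtain ⟨p, hp, hcov⟩ := hmix.exists_covLe (ε := 1 / 44) (by norm_num)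
    exact exists_integral_sumOver_pow_four_le hξ hf hM hp (by norm_num) le_rfl hcov hc
  rw [tendsto_iff_norm_sub_tendsto_zero, Metric.tendsto_atTop']
  intro ε hε
  have hdiv : ∀ a : ℝ, Tendsto (fun k : ℕ => a / k) atTop (𝓝 0) :=
    tendsto_const_div_atTop_nhds_zero_nat
  have hk1 : Tendsto (fun k : ℕ => 4 * (√(c ^ 2 * t ^ 2 / k) * (√C * t ^ 2))
      + (t ^ 2 * v ^ 2 / 2) ^ 2 / k) atTop (𝓝 0) := by
    have h := ((((Real.continuous_sqrt.tendsto _).comp (hdiv (c ^ 2 * t ^ 2))).mul_const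
      (√C * t ^ 2)).const_mul 4).add (hdiv ((t ^ 2 * v ^ 2 / 2) ^ 2))
    simpa using h
  -- First k: the Taylor and exponential errors of all k blocks together are of order k^(-1/2) and
  -- 1/k. Then p, with correlation so small that factoring costs 4rk = ε/4. The remaining errors
  -- vanish as n grows.
  obtain ⟨k, ⟨hkε, hkx⟩, hk⟩ := (((hk1.eventually_lt_const (half_pos hε)).and
    ((hdiv (t ^ 2 * v ^ 2 / 2)).eventually_le_const one_pos)).and (eventually_ge_atTop 1)).exists
  have hk' : (0 : ℝ) < k := by exact_mod_cast hk
  obtain ⟨p, hp, hcov⟩ := hmix.exists_covLe (ε := ε / (16 * k)) (by positivity)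
  have hW : Tendsto (fun n : ℕ =>
      (∫ ω, sumOver ξ f (Finset.Ioc (0 : ℤ) (n / k - p : ℕ)) ω ^ 2 ∂P) / n) atTop
      (𝓝 (v ^ 2 / k)) := by
    have hl : Tendsto (fun n : ℕ => n / k - p) atTop atTop :=
      (tendsto_sub_atTop_nat p).comp (Nat.tendsto_div_const_atTop (by omega))
    have h := ((hv.comp hl).pow 2).mul (tendsto_div_sub_div_natCast hk p)
    rw [mul_one_div] at h
    refine h.congr' ?_
    filter_upwards [hl.eventually_ge_atTop 1] with n hn
    have hn' : ((n / k - p : ℕ) : ℝ) ≠ 0 := by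
      have : n / k - p ≠ 0 := by omega
      exact_mod_cast this
    simp only [Function.comp_apply]
    rw [div_pow, Real.sq_sqrt (integral_sq_nonneg _), Real.sq_sqrt (Nat.cast_nonneg _)]
    field_simp
  have hlim : Tendsto (fun n : ℕ => √(t ^ 2 * (c ^ 2 * (k * p + k)) / n)
      + k * (t ^ 2 / 2
        * |(∫ ω, sumOver ξ f (Finset.Ioc (0 : ℤ) (n / k - p : ℕ)) ω ^ 2 ∂P) / n - v ^ 2 / k|))
      atTop (𝓝 0) := by
    have h := ((Real.continuous_sqrt.tendsto _).comp (hdiv (t ^ 2 * (c ^ 2 * (k * p + k))))).add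
      (((hW.sub_const (v ^ 2 / k)).abs.const_mul (t ^ 2 / 2)).const_mul (k : ℝ))
    simpa using h
  obtain ⟨N, hN⟩ := eventually_atTop.1 ((hlim.eventually_lt_const
    (show (0 : ℝ) < ε / 4 by positivity)).and (eventually_ge_atTop (k * p)))
  refine ⟨N, fun n hn => ?_⟩
  obtain ⟨h1, h2⟩ := hN n hn.le
  rw [dist_zero_right, norm_norm]
  have hx : t ^ 2 * v ^ 2 / (2 * k) ≤ 1 := by rwa [← div_div]
  have h3 := norm_charE_sum_sub_exp_le hξ hf hstat hM hf0' hC0 hc hC hp (by positivity) hcov hk h2 hx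
  refine h3.trans_lt ?_
  have e1 : (k : ℝ) * (4 * (√(c ^ 2 * (t ^ 2 / k)) * (√C * (t ^ 2 / k))))
      = 4 * (√(c ^ 2 * t ^ 2 / k) * (√C * t ^ 2)) := by
    rw [mul_div_assoc]; field_simp
  have e2 : (k : ℝ) * (t ^ 2 * v ^ 2 / (2 * k)) ^ 2 = (t ^ 2 * v ^ 2 / 2) ^ 2 / k := by
    field_simp
  have e3 : 4 * (ε / (16 * k)) * k = ε / 4 := by field_simp; norm_num
  rw [mul_add (k : ℝ), mul_add (k : ℝ), e1, e2, e3]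
  linarith

end Bounded

/-! ### Approximation by bounded functions and the general limit -/

section General

variable {Ω S : Type*} [mΩ : MeasurableSpace Ω] [mS : MeasurableSpace S] {P : Measure Ω}
  [IsProbabilityMeasure P] {ξ : ℤ → Ω → S} {f : S → ℝ}

/-- A simple function close to `f` in L² is recentred. As `f` has mean zero, this centres the
difference too, so its second moment does not increase. -/
lemma exists_bounded_centered_approx (hξ : Measurable (ξ 0)) (hf : Measurable f)
    (hf2 : MemLp f 2 (P.map (ξ 0))) (hf0 : ∫ ω, f (ξ 0 ω) ∂P = 0) {η : ℝ} (hη : 0 < η) :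
    ∃ g : S → ℝ, Measurable g ∧ (∃ M, ∀ x, |g x| ≤ M) ∧ ∫ ω, g (ξ 0 ω) ∂P = 0 ∧
      ∫ ω, (f (ξ 0 ω) - g (ξ 0 ω)) ^ 2 ∂P ≤ η ^ 2 := by
  obtain ⟨g₀, hg, hg2⟩ := hf2.exists_simpleFunc_eLpNorm_sub_lt (by norm_num)
    (ε := ENNReal.ofReal η) (by simpa using hη)
  obtain ⟨M, hM⟩ := g₀.exists_forall_norm_le
  have hfξ : MemLp (fun ω => f (ξ 0 ω)) 2 P := hf2.comp_of_map hξ.aemeasurable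
  have hgξ : MemLp (fun ω => g₀ (ξ 0 ω)) 2 P := hg2.comp_of_map hξ.aemeasurable
  have hfi := hfξ.integrable (by norm_num : (1 : ℝ≥0∞) ≤ 2)
  have hgi := hgξ.integrable (by norm_num : (1 : ℝ≥0∞) ≤ 2)
  set m := ∫ ω, g₀ (ξ 0 ω) ∂P with hm
  refine ⟨fun x => g₀ x - m, g₀.measurable.sub_const m, ⟨M + |m|, fun x => ?_⟩, ?_, ?_⟩
  · exact (abs_sub _ _).trans (add_le_add (hM x) le_rfl)
  · rw [integral_sub hgi (integrable_const _)]
    simp [hm]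
  · have h1 := integral_sub_integral_sq_le (P := P) (hfξ.sub hgξ)
    have h2 : ∫ ω, ((fun ω => f (ξ 0 ω)) - fun ω => g₀ (ξ 0 ω)) ω ∂P = -m := by
      simp only [Pi.sub_apply]
      rw [integral_sub hfi hgi, hf0, zero_sub]
    rw [h2] at h1
    simp only [Pi.sub_apply] at h1
    have h3 : ∫ ω, (f (ξ 0 ω) - g₀ (ξ 0 ω)) ^ 2 ∂P ≤ η ^ 2 := by
      have h4 := l2Norm_sq (hf2.sub hg2)
      rw [integral_map hξ.aemeasurable
        ((hf.sub g₀.measurable).pow_const 2).aestronglyMeasurable] at h4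
      simp only [Pi.sub_apply] at h4
      rw [← h4]
      refine pow_le_pow_left₀ ENNReal.toReal_nonneg ?_ 2
      exact ENNReal.toReal_le_of_le_ofReal hη.le hg.le
    refine le_trans (le_of_eq ?_) (h1.trans h3)
    refine integral_congr_ae (ae_of_all _ fun ω => ?_)
    simp only
    ring

variable (hξ : ∀ k, Measurable (ξ k)) (hstat : IsStationary P ξ) (hmix : IsRhoStarMixing P ξ)
  (hf : Measurable f)

include hξ hstat hmix hf

/-- Approximation by a bounded centred g. The linear variance bound for f - g controls, uniformly in
n, both the distance of the characteristic functions and that of the limits w and v of the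
normalized norms. -/
theorem tendsto_charE (hf2 : MemLp f 2 (P.map (ξ 0))) (hf0 : ∫ ω, f (ξ 0 ω) ∂P = 0) {v : ℝ}
    (hv : Tendsto (fun n : ℕ => √(∫ ω, sumOver ξ f (Finset.Ioc (0 : ℤ) n) ω ^ 2 ∂P) / √n)
      atTop (𝓝 v)) (t : ℝ) :
    Tendsto (fun n : ℕ => charE P (fun ω => t / √n * sumOver ξ f (Finset.Ioc (0 : ℤ) n) ω)) atTop
      (𝓝 (Real.exp (-(t ^ 2 * v ^ 2 / 2)) : ℂ)) := by
  have hfξ : MemLp (fun ω => f (ξ 0 ω)) 2 P := hf2.comp_of_map (hξ 0).aemeasurable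
  obtain ⟨p, hp, hcov⟩ := hmix.exists_covLe (ε := 1 / 2) (by norm_num)
  have hcont : Continuous fun w : ℝ => (Real.exp (-(t ^ 2 * w ^ 2 / 2)) : ℂ) := by fun_prop
  rw [Metric.tendsto_atTop']
  intro ε hε
  obtain ⟨δ, hδ, hδε⟩ := Metric.continuous_iff.1 hcont v (ε / 3) (by positivity)
  have hp' : (0 : ℝ) < p := by exact_mod_cast hp
  obtain ⟨η, hη0, hηδ, hηε⟩ : ∃ η > 0, √(3 * p) * η < δ ∧ |t| * (√(3 * p) * η) < ε / 3 := by
    have h1 : Tendsto (fun η : ℝ => √(3 * p) * η) (𝓝[>] 0) (𝓝 0) := by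
      refine (Continuous.tendsto' (by fun_prop) 0 0 (by simp)).mono_left nhdsWithin_le_nhds
    have h2 := h1.const_mul |t|
    rw [mul_zero] at h2
    obtain ⟨η, ⟨h3, h4⟩, h5⟩ := (((h1.eventually_lt_const hδ).and
      (h2.eventually_lt_const (show 0 < ε / 3 by positivity))).and self_mem_nhdsWithin).exists
    exact ⟨η, h5, h3, h4⟩
  obtain ⟨g, hg, ⟨M, hM⟩, hg0, hgη⟩ := exists_bounded_centered_approx (hξ 0) hf hf2 hf0 hη0
  have hgξ : MemLp (fun ω => g (ξ 0 ω)) 2 P :=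
    memLp_of_abs_le (hg.comp (hξ 0)) (fun ω => hM _) 2
  have hfg : Measurable fun x => f x - g x := hf.sub hg
  have hhξ : MemLp (fun ω => f (ξ 0 ω) - g (ξ 0 ω)) 2 P := hfξ.sub hgξ
  have hh0 : ∫ ω, (f (ξ 0 ω) - g (ξ 0 ω)) ∂P = 0 := by
    rw [integral_sub (hfξ.integrable (by norm_num)) (hgξ.integrable (by norm_num)), hf0, hg0,
      sub_zero]
  have hsub : ∀ s ω, sumOver ξ f s ω - sumOver ξ g s ω = sumOver ξ (fun x => f x - g x) s ω :=
    fun s ω => (Finset.sum_sub_distrib _ _).symm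
  have hfS := memLp_sumOver hξ hstat hf hfξ
  have hgS := memLp_sumOver hξ hstat hg hgξ
  have hdiff : ∀ n : ℕ, √(∫ ω, (sumOver ξ f (Finset.Ioc (0 : ℤ) n) ω
      - sumOver ξ g (Finset.Ioc (0 : ℤ) n) ω) ^ 2 ∂P) ≤ √(3 * p) * η * √n := by
    intro n
    simp only [hsub]
    rw [Real.sqrt_le_left (by positivity), mul_pow, mul_pow, Real.sq_sqrt (by positivity),
      Real.sq_sqrt (Nat.cast_nonneg _)]
    have h := integral_sumOver_sq_le hξ hstat hfg hhξ hh0 hp hcov (Finset.Ioc (0 : ℤ) n)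
    simp only [Int.card_Ioc, sub_zero, Int.toNat_natCast] at h
    exact h.trans (by gcongr)
  obtain ⟨w, hw⟩ := tendsto_sqrt_integral_sq_div hξ hstat hg hgξ hg0 hmix
  have hwv : dist w v < δ := by
    refine lt_of_le_of_lt (le_of_tendsto (hw.sub hv).abs ?_) hηδ
    filter_upwards [eventually_ge_atTop 1] with n hn
    have hn' : (0 : ℝ) < √n := Real.sqrt_pos.2 (by exact_mod_cast hn)
    rw [← sub_div, abs_div, abs_of_pos hn', div_le_iff₀ hn', abs_sub_comm]
    exact (abs_sqrt_integral_sq_sub_le (hfS _) (hgS _)).trans (hdiff n)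
  have hclt := tendsto_charE_of_abs_le hξ hg hstat hmix hM hg0 hw t
  obtain ⟨N, hN⟩ := (Metric.tendsto_atTop.1 hclt) (ε / 3) (by positivity)
  refine ⟨max N 1, fun n hn => ?_⟩
  have hn1 : 1 ≤ n := (le_max_right N 1).trans hn.le
  have hn' : (0 : ℝ) < √n := Real.sqrt_pos.2 (by exact_mod_cast hn1)
  have h1 : dist (charE P (fun ω => t / √n * sumOver ξ f (Finset.Ioc (0 : ℤ) n) ω))
      (charE P (fun ω => t / √n * sumOver ξ g (Finset.Ioc (0 : ℤ) n) ω)) < ε / 3 := by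
    rw [dist_eq_norm]
    have hX := (measurable_sumOver hξ hf (Finset.Ioc (0 : ℤ) n)).const_mul (t / √n)
    have hY := (measurable_sumOver hξ hg (Finset.Ioc (0 : ℤ) n)).const_mul (t / √n)
    refine lt_of_le_of_lt ((norm_charE_sub_le hX hY
      (((hfS _).const_mul _).sub ((hgS _).const_mul _))).trans ?_) hηε
    simp only [← mul_sub, mul_pow]
    rw [integral_const_mul, Real.sqrt_mul (sq_nonneg _), Real.sqrt_sq_eq_abs, abs_div,
      abs_of_pos hn', div_mul_eq_mul_div, div_le_iff₀ hn', mul_assoc]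
    exact mul_le_mul_of_nonneg_left (hdiff n) (abs_nonneg t)
  have h2 := hN n ((le_max_left N 1).trans hn.le)
  have h3 := hδε w hwv
  have h4 := dist_triangle4 (charE P (fun ω => t / √n * sumOver ξ f (Finset.Ioc (0 : ℤ) n) ω))
    (charE P (fun ω => t / √n * sumOver ξ g (Finset.Ioc (0 : ℤ) n) ω))
    (Real.exp (-(t ^ 2 * w ^ 2 / 2)) : ℂ) (Real.exp (-(t ^ 2 * v ^ 2 / 2)) : ℂ)
  linarith

/-- Lévy's continuity theorem; the degenerate case of zero variance needs no separate argument. -/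
theorem tendstoInDistribution_partialSum (hf2 : MemLp f 2 (P.map (ξ 0)))
    (hf0 : ∫ ω, f (ξ 0 ω) ∂P = 0) {v : ℝ}
    (hv : Tendsto (fun n : ℕ => √(∫ ω, sumOver ξ f (Finset.Ioc (0 : ℤ) n) ω ^ 2 ∂P) / √n)
      atTop (𝓝 v)) {σ2 : ℝ≥0} (hσ : (σ2 : ℝ) = v ^ 2) :
    TendstoInDistribution (fun (n : ℕ) ω => partialSum ξ f n ω / √(n : ℝ)) atTop
      (id : ℝ → ℝ) (fun _ => P) (gaussianReal 0 σ2) := by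
  have hm : ∀ n : ℕ, Measurable fun ω => partialSum ξ f n ω / √(n : ℝ) := fun n => by
    rw [partialSum_eq_sumOver]
    exact (measurable_sumOver hξ hf _).div_const _
  refine ⟨fun n => (hm n).aemeasurable, aemeasurable_id, ?_⟩
  refine ProbabilityMeasure.tendsto_iff_tendsto_charFun.2 fun t => ?_
  have h := tendsto_charE hξ hstat hmix hf hf2 hf0 hv t
  have h1 : charFun ((gaussianReal 0 σ2).map id) t = (Real.exp (-(t ^ 2 * v ^ 2 / 2)) : ℂ) := by
    rw [Measure.map_id, charFun_gaussianReal, ← hσ]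
    push_cast
    congr 1
    ring
  have h2 : ∀ n : ℕ, charFun (P.map fun ω => partialSum ξ f n ω / √(n : ℝ)) t
      = charE P (fun ω => t / √n * sumOver ξ f (Finset.Ioc (0 : ℤ) n) ω) := fun n => by
    rw [charFun_apply_real, integral_map (hm n).aemeasurable (by fun_prop), charE]
    refine integral_congr_ae (ae_of_all _ fun ω => ?_)
    simp only [partialSum_eq_sumOver]
    congr 1
    push_cast
    ring
  simp only [ProbabilityMeasure.coe_mk, h1, h2]
  exact h

end General

end InterlacedMixing

/-! ### The main theorem -/

open InterlacedMixing in
theorem corollary9 {Ω S : Type*} [MeasurableSpace Ω] [MeasurableSpace S]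
    (P : Measure Ω) [IsProbabilityMeasure P]
    (ξ : ℤ → Ω → S) (hξ : ∀ k, Measurable (ξ k))
    (hstat : IsStationary P ξ) (hmarkov : IsMarkovChain P ξ) (hmix : IsRhoStarMixing P ξ)
    (f : S → ℝ) (hf : Measurable f) (hf2 : MemLp f 2 (P.map (ξ 0)))
    (hf0 : ∫ x, f x ∂(P.map (ξ 0)) = 0) :
    ∃ σ2 : ℝ≥0,
      Tendsto (fun n : ℕ =>
        (1 / (n : ℝ)) * l2Norm P (fun ω => partialSum ξ f n ω - condMean P ξ f n ω) ^ 2)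
        atTop (𝓝 (σ2 : ℝ)) ∧
      Tendsto (fun n : ℕ => (1 / (n : ℝ)) * l2Norm P (condMean P ξ f n) ^ 2) atTop (𝓝 0) ∧
      Tendsto (fun n : ℕ => (∫ ω, partialSum ξ f n ω ^ 2 ∂P) / (n : ℝ)) atTop (𝓝 (σ2 : ℝ)) ∧
      TendstoInDistribution (fun (n : ℕ) ω => partialSum ξ f n ω / √(n : ℝ)) atTop
        (id : ℝ → ℝ) (fun _ => P) (gaussianReal 0 σ2) := by
  have hfξ : MemLp (fun ω => f (ξ 0 ω)) 2 P := hf2.comp_of_map (hξ 0).aemeasurable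
  have hfξ0 : ∫ ω, f (ξ 0 ω) ∂P = 0 := by
    rw [← hf0, integral_map (hξ 0).aemeasurable hf.aestronglyMeasurable]
  obtain ⟨v, hv⟩ := tendsto_sqrt_integral_sq_div hξ hstat hf hfξ hfξ0 hmix
  have hV := tendsto_integral_condMean_sq_div hξ hstat hf hfξ hfξ0 hmix
  have hcond : ∀ n, MemLp (condMean P ξ f n) 2 P := memLp_condMean hξ hstat hf hfξ
  have hsum : ∀ n, MemLp (partialSum ξ f n) 2 P := fun n => by
    rw [partialSum_eq_sumOver]
    exact memLp_sumOver hξ hstat hf hfξ _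
  have hS : Tendsto (fun n : ℕ => (∫ ω, partialSum ξ f n ω ^ 2 ∂P) / (n : ℝ)) atTop
      (𝓝 (v ^ 2)) := by
    simp only [partialSum_eq_sumOver]
    refine (hv.pow 2).congr fun n => ?_
    rw [div_pow, Real.sq_sqrt (integral_sq_nonneg _), Real.sq_sqrt (Nat.cast_nonneg _)]
  refine ⟨⟨v ^ 2, sq_nonneg v⟩, ?_, ?_, hS,
    tendstoInDistribution_partialSum hξ hstat hmix hf hf2 hfξ0 hv rfl⟩
  · have h := hS.sub hV
    rw [sub_zero] at h
    refine h.congr fun n => ?_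
    have h1 : MemLp (fun ω => partialSum ξ f n ω - condMean P ξ f n ω) 2 P :=
      (hsum n).sub (hcond n)
    -- Pythagoras: the residual variance is the full second moment minus that of the conditional
    -- mean, which is o(n).
    have h2 := integral_sub_condExp_sq (P := P) (sigmaGen_le hξ {0, (n : ℤ)}) (hsum n)
    rw [l2Norm_sq h1, ← sub_div, one_div, inv_mul_eq_div]
    simp only [condMean]
    rw [h2]
  · refine hV.congr fun n => ?_
    rw [l2Norm_sq (hcond n), one_div, inv_mul_eq_div]
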